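/- Let $Z$ be a complex Banach space with Borel $\sigma$-algebra $\mathcal B_Z$, let $A$ be a bounded linear operator on $Z$, and let $d\lambda$ be the normalized Lebesgue measure on $\mathbb T=\{\lambda\in\mathbb C:|\lambda|=1\}$. Suppose that there is $E\in L^2(\mathbb T;Z)$ (that is, $E:\mathbb T\to Z$ is strongly measurable and $\int_{\mathbb T}\|E(\lambda)\|^2\,d\lambda<\infty$) such that $A\,E(\lambda)=\lambda E(\lambda)$ for almost every $\lambda\in\mathbb T$ and such that: (i) for every Borel set $B\subseteq\mathbb T$ of full Lebesgue measure, the linear span of $\{E(\lambda):\lambda\in B\}$ is dense in $Z$; (ii) there are a non-zero continuous linear functional $z_0^*\in Z^*$ and a trigonometric polynomial $p(\lambda)=\sum_{|k|\le d}c_k\lambda^k$ with $\langle z_0^*,E(\lambda)\rangle=p(\lambda)$ for almost every $\lambda\in\mathbb T$; (iii) with $\widehat E(n)=\int_{\mathbb T}\lambda^{-n}E(\lambda)\,d\lambda$ for $n\in\mathbb Z$, the series $\sum_{n\in\mathbb Z}\widehat E(n)$ converges unconditionally in $Z$. Then $A$ is universal for invertible ergodic systems: for every standard Borel space $X$ with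 an atomless probability measure $\mu$ and every ergodic measure-preserving transformation $T$ of $(X,\mu)$ which is invertible modulo null sets, there is an $A$-invariant Borel probability measure $\nu$ on $Z$ with full support (every non-empty open set has positive $\nu$-measure) such that the systems $(X,\mu;T)$ and $(Z,\mathcal B_Z,\nu;A)$ are isomorphic. Here isomorphic means that there is a measure-preserving map $\Phi:(X,\mu)\to(Z,\nu)$, invertible modulo null sets with a measure-preserving inverse, such that $\Phi\circ T=A\circ\Phi$ $\mu$-almost everywhere. If moreover $\widehat E(-r)=0$ for some $r\in\mathbb Z$, then $\widehat E(-n)=0$ for every $n\ge r$, and $A$ is universal for ergodic systems: the same property holds for all ergodic measure-preserving transformations $T$ of atomless standard Borel probability spaces, invertible or not. -/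

import Mathlib

open MeasureTheory

universe u v

noncomputable section

/-- The Borel `σ`-algebra of the unit circle. -/
instance instMeasurableSpaceCircle : MeasurableSpace Circle := borel Circle

instance instBorelSpaceCircle : BorelSpace Circle := ⟨rfl⟩

/-- Normalized Lebesgue measure on the unit circle `𝕋 ⊆ ℂ`: the image of the Haar probability
measure of `ℝ / ℤ` under `t ↦ exp (2 π i t)`. -/
def circleMeasure : Measure Circle :=
  Measure.map (AddCircle.toCircle (T := (1 : ℝ))) (AddCircle.haarAddCircle (T := (1 : ℝ)))

/-- `(X, μ; T)` is invertible as a measure-preserving system: `T` has a measure-preserving inverse,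
up to null sets. -/
def IsInvertibleSystem {X : Type v} [MeasurableSpace X] (μ : Measure X) (T : X → X) : Prop :=
  ∃ S : X → X, MeasurePreserving S μ μ ∧ (∀ᵐ x ∂μ, S (T x) = x) ∧ (∀ᵐ x ∂μ, T (S x) = x)

/-- Isomorphism (modulo null sets) of the dynamical systems `(X, μ; T)` and `(Y, ν; S)`: there is a
measure-preserving map `Φ : X → Y`, invertible up to null sets with measure-preserving
inverse `Ψ`, which intertwines `T` and `S` almost everywhere. -/
def IsomorphicSystems {X : Type v} {Y : Type u} [MeasurableSpace X] [MeasurableSpace Y]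
    (μ : Measure X) (T : X → X) (ν : Measure Y) (S : Y → Y) : Prop :=
  ∃ (Φ : X → Y) (Ψ : Y → X), MeasurePreserving Φ μ ν ∧ MeasurePreserving Ψ ν μ ∧
    (∀ᵐ x ∂μ, Ψ (Φ x) = x) ∧ (∀ᵐ y ∂ν, Φ (Ψ y) = y) ∧ (∀ᵐ x ∂μ, Φ (T x) = S (Φ x))

section Operators

variable {Z : Type u} [NormedAddCommGroup Z] [NormedSpace ℂ Z]

/-- The system `(X, μ; T)` is modelled by `A`: there is an `A`-invariant Borel probability measure
with full support on `Z` such that `(X, μ; T)` and `(Z, ν; A)` are isomorphic. -/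
def IsModelledBy [MeasurableSpace Z] (A : Z →L[ℂ] Z)
    {X : Type v} [MeasurableSpace X] (μ : Measure X) (T : X → X) : Prop :=
  ∃ ν : Measure Z, IsProbabilityMeasure ν ∧ ν.IsOpenPosMeasure ∧ MeasurePreserving A ν ν ∧
    IsomorphicSystems μ T ν A

/-- `A` is universal for ergodic systems. A standard Lebesgue probability space is a standard Borel
space with an atomless probability measure (on such a space, this means that all singletons are
null). -/
def IsUniversalForErgodicSystems [MeasurableSpace Z] (A : Z →L[ℂ] Z) : Prop :=
  ∀ (X : Type v) [MeasurableSpace X] [StandardBorelSpace X] (μ : Measure X)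
    [IsProbabilityMeasure μ] [NullSingletonClass μ] (T : X → X), Ergodic T μ → IsModelledBy A μ T

/-- `A` is universal for invertible ergodic systems. -/
def IsUniversalForInvertibleErgodicSystems [MeasurableSpace Z] (A : Z →L[ℂ] Z) : Prop :=
  ∀ (X : Type v) [MeasurableSpace X] [StandardBorelSpace X] (μ : Measure X)
    [IsProbabilityMeasure μ] [NullSingletonClass μ] (T : X → X),
    Ergodic T μ → IsInvertibleSystem μ T → IsModelledBy A μ T

/-- `E` is an eigenvectorfield of `A` belonging to `L²(𝕋; Z)`. -/
def IsL2Eigenvectorfield (A : Z →L[ℂ] Z) (E : Circle → Z) : Prop :=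
  MemLp E 2 circleMeasure ∧ ∀ᵐ l ∂circleMeasure, A (E l) = (l : ℂ) • E l

/-- The Fourier coefficient `Ê(n) = ∫ λ⁻ⁿ E(λ) dλ`. -/
def circleFourierCoeff (E : Circle → Z) (n : ℤ) : Z :=
  ∫ l : Circle, ((l : ℂ) ^ (-n)) • E l ∂circleMeasure

end Operators

/-- The value at `λ ∈ 𝕋` of the trigonometric polynomial `∑ cₙ λⁿ` (a finite sum over `n ∈ ℤ`). -/
def trigPolyEval (c : ℤ →₀ ℂ) (l : Circle) : ℂ :=
  c.sum fun n a => a * (l : ℂ) ^ n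

end

/-!
Write `y n = Ê(n)`. Integrating `A E(λ) = λ E(λ)` against `λ⁻ⁿ` gives `A y (n + 1) = y n`, so for
a function `f` on `X` the series `Φ_f(x) = ∑ f(Tⁿ x) y n` satisfies `A ∘ Φ_f = Φ_f ∘ T`
(`ae_orbitSum_map`). It converges when `f` is bounded, by unconditional convergence of `∑ y n`,
and the image measure of `μ` under it is `A`-invariant. It remains to choose `f` such that this
measure has full support and `Φ_f` is injective modulo a null set. A bounded `f` is not enough for
full support, since then `Φ_f` has a relatively compact range. Instead `(f, Φ)` is taken in the
closure of the pairs `(f, Φ_f)`, `f` simple, in `L¹ × L¹`, as a generic element in the sense of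
Baire (`exists_generic_pair`). Two perturbation lemmas show that the relevant open sets are dense.

* `exists_simpleFunc_orbitSum_mem_open`: the span of the `y n` is dense, because the Fourier
  coefficients determine `w ∘ E` for each functional `w`. Redefining `f` on a short tower over a
  small set `D` makes `Φ_f` close to a given finite combination of the `y n` on a set of positive
  measure.
* `exists_simpleFunc_separating`: for `∑ q k * f(T^k x)` with `q 0 ≠ 0`, a small perturbation of
  `f` makes the value at `x` decide, up to a small set, whether `x` lies in a given set. The
  perturbation encodes the time at which `x` enters `D` in the degree of a polynomial, which the
  later terms of the orbit cannot cancel, as they have lower degree.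

As `z₀(y n)` is the `n`-th coefficient of a trigonometric polynomial, `z₀ ∘ Φ` is such a finite
combination, evaluated at `T^[m] x`, so that `Φ x` determines `T^[m] x`. For invertible `T` one
shifts indices to have `m = 0`. Otherwise the `y n` vanish for `n < 0` and `y 0 ≠ 0` after a
shift. A functional `w` with `w (y 0) = 1` then gives `w (Φ x) = f x + u (T x)` for some `u`, and
since `f` is injective as well, `T^[j] x` is determined for `j = m - 1, …, 0`
(`isModelledBy_of_isOrbitFamily`). The Lusin–Souslin theorem turns injectivity into an isomorphism
of systems.
-/

/-! ### Small sets and hitting times of ergodic transformations -/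

section HitTime

variable {X : Type v}

/-- The first time at which the orbit of `x` meets `D`, capped at `N + 1`. -/
noncomputable def hitTime (T : X → X) (D : Set X) (N : ℕ) (x : X) : ℕ :=
  sInf {i | T^[i] x ∈ D ∨ i = N + 1}

variable {T : X → X} {D : Set X} {N : ℕ} {x : X}

theorem hitTime_spec : T^[hitTime T D N x] x ∈ D ∨ hitTime T D N x = N + 1 :=
  Nat.sInf_mem (s := {i | T^[i] x ∈ D ∨ i = N + 1}) ⟨N + 1, Or.inr rfl⟩

theorem hitTime_le : hitTime T D N x ≤ N + 1 := Nat.sInf_le (Or.inr rfl)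

theorem hitTime_le_of_mem {i : ℕ} (h : T^[i] x ∈ D) : hitTime T D N x ≤ i := Nat.sInf_le (Or.inl h)

theorem iterate_hitTime_mem (h : hitTime T D N x ≤ N) : T^[hitTime T D N x] x ∈ D :=
  hitTime_spec.resolve_right (by lia)

theorem hitTime_iterate {k : ℕ} (hN : hitTime T D N x ≤ N) (hk : k ≤ hitTime T D N x) :
    hitTime T D N (T^[k] x) = hitTime T D N x - k := by
  have h1 := iterate_hitTime_mem hN
  have h2 : T^[hitTime T D N x - k] (T^[k] x) ∈ D := by
    rwa [← Function.iterate_add_apply, Nat.sub_add_cancel hk]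
  refine le_antisymm (hitTime_le_of_mem h2) ?_
  have h3 : hitTime T D N (T^[k] x) ≤ N := (hitTime_le_of_mem h2).trans (by lia)
  have h4 := iterate_hitTime_mem h3
  rw [← Function.iterate_add_apply] at h4
  have := hitTime_le_of_mem (N := N) h4
  lia

end HitTime

section Ergodic

variable {X : Type v} [MeasurableSpace X] {μ : Measure X} {T : X → X} {D : Set X} {N : ℕ}

/-- If the maps `τ i` move almost every point, then every non-null set contains a small non-null set
that is disjoint from its preimages under them: separate almost every point from its finitely many
images by basic open sets of small measure, of which there are only countably many. -/
theorem exists_small_measurableSet_disjoint_preimage [StandardBorelSpace X] [IsFiniteMeasure μ]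
    [NullSingletonClass μ] {ι : Type*} (I : Finset ι) (τ : ι → X → X)
    (hτ : ∀ i, Measurable (τ i)) {s : Set X} (hs : MeasurableSet s) (hμs : μ s ≠ 0)
    (h : ∀ᵐ x ∂μ, ∀ i ∈ I, τ i x ≠ x) {δ : ENNReal} (hδ : δ ≠ 0) :
    ∃ D ⊆ s, MeasurableSet D ∧ μ D ≠ 0 ∧ μ D < δ ∧ ∀ i ∈ I, Disjoint D (τ i ⁻¹' D) := by
  let := upgradeStandardBorel X
  classical
  let 𝓑 := {U ∈ TopologicalSpace.countableBasis X | μ U < δ}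
  have h𝓑 : 𝓑.Countable := (TopologicalSpace.countable_countableBasis X).mono fun _ h => h.1
  let V : Set X → Set X := fun U => (s ∩ U) \ ⋃ i ∈ I, τ i ⁻¹' U
  have hcover : ∀ᵐ x ∂μ, x ∈ s → x ∈ ⋃ U ∈ 𝓑, V U := by
    filter_upwards [h] with x hx hxs
    have h1 : μ {x} < δ := by simpa using pos_iff_ne_zero.2 hδ
    obtain ⟨W, hW, hWo, hWδ⟩ := ({x} : Set X).exists_isOpen_lt_of_lt δ h1
    have hF : IsClosed (((I.image fun i => τ i x : Finset X)) : Set X) :=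
      (Finset.finite_toSet _).isClosed
    have hxF : x ∈ W ∩ (((I.image fun i => τ i x : Finset X)) : Set X)ᶜ := by
      refine ⟨hW rfl, ?_⟩
      simp only [Finset.coe_image, Set.mem_compl_iff, Set.mem_image, not_exists, not_and]
      exact fun i hi => hx i (by simpa using hi)
    obtain ⟨U, hU, hxU, hUs⟩ := (TopologicalSpace.isBasis_countableBasis X).exists_subset_of_mem_open
      hxF (hWo.inter hF.isOpen_compl)
    refine Set.mem_iUnion₂.2 ⟨U, ⟨hU, (measure_mono (hUs.trans Set.inter_subset_left)).trans_lt hWδ⟩,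
      ⟨hxs, hxU⟩, ?_⟩
    simp only [Set.mem_iUnion, not_exists]
    intro i hi hiU
    exact (hUs hiU).2 (by simpa using ⟨i, hi, rfl⟩)
  have : ∃ U ∈ 𝓑, μ (V U) ≠ 0 := by
    by_contra! hcon
    apply hμs
    have h0 : μ (⋃ U ∈ 𝓑, V U) = 0 := (measure_biUnion_null_iff h𝓑).2 hcon
    refine measure_mono_null_ae (t := ⋃ U ∈ 𝓑, V U) hcover h0
  obtain ⟨U, hU, hVU⟩ := this
  have hUm : MeasurableSet U := (TopologicalSpace.isOpen_of_mem_countableBasis hU.1).measurableSet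
  refine ⟨V U, fun x hx => hx.1.1, ?_, hVU, ?_, ?_⟩
  · exact (hs.inter hUm).diff (Finset.measurableSet_biUnion I fun i _ => hτ i hUm)
  · exact (measure_mono fun x hx => hx.1.2).trans_lt hU.2
  · intro i hi
    rw [Set.disjoint_left]
    intro x hx hx'
    exact hx.2 (Set.mem_iUnion₂.2 ⟨i, hi, hx'.1.2⟩)

theorem Ergodic.ae_exists_iterate_mem [IsFiniteMeasure μ] (hT : Ergodic T μ) {D : Set X}
    (hD : MeasurableSet D) (hμD : μ D ≠ 0) : ∀ᵐ x ∂μ, ∃ n : ℕ, T^[n] x ∈ D := by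
  have hm : MeasurableSet (⋃ n : ℕ, T^[n] ⁻¹' D) :=
    MeasurableSet.iUnion fun n => (hT.measurable.iterate n) hD
  have hle : T ⁻¹' (⋃ n : ℕ, T^[n] ⁻¹' D) ⊆ ⋃ n : ℕ, T^[n] ⁻¹' D := by
    intro x hx
    obtain ⟨n, hn⟩ := Set.mem_iUnion.1 hx
    exact Set.mem_iUnion.2 ⟨n + 1, hn⟩
  rcases hT.ae_empty_or_univ_of_preimage_ae_le hm.nullMeasurableSet
    (LE.le.eventuallyLE hle) with h | h
  · exact absurd (measure_mono_null (Set.subset_iUnion (fun n : ℕ => T^[n] ⁻¹' D) 0)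
      (ae_eq_empty.1 h)) hμD
  · filter_upwards [h.mem_iff] with x hx
    simpa using hx

/-- An ergodic transformation of an atomless space is aperiodic: the `n`-periodic points form an
invariant set, and if they had full measure then the saturation of any small set would be
the union of `n` of its preimages, which does not exhaust the space. -/
theorem Ergodic.ae_iterate_ne [StandardBorelSpace X] [IsProbabilityMeasure μ]
    [NullSingletonClass μ] (hT : Ergodic T μ) {n : ℕ} (hn : n ≠ 0) : ∀ᵐ x ∂μ, T^[n] x ≠ x := by
  by_contra hcon
  let P : Set X := {x | T^[n] x = x}
  have hTn := hT.measurable.iterate n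
  have hP : MeasurableSet P := measurableSet_eq_fun hTn measurable_id
  have hμP : μ P ≠ 0 := by
    rw [ae_iff] at hcon
    simpa [P] using hcon
  obtain ⟨C, hCP, hC, hμC, hCn, -⟩ := exists_small_measurableSet_disjoint_preimage (μ := μ)
    (∅ : Finset ℕ) (fun _ x => x) (fun _ => measurable_id) hP hμP (by simp)
    (δ := (n : ENNReal)⁻¹) (by simp)
  have hPinv : ∀ᵐ x ∂μ, x ∈ P := by
    have hle : P ⊆ T ⁻¹' P := fun x (hx : T^[n] x = x) => show T^[n] (T x) = T x by
      rw [← Function.iterate_succ_apply, Function.iterate_succ_apply', hx]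
    have h := (hT.ae_empty_or_univ_of_ae_le_preimage hP.nullMeasurableSet
      (LE.le.eventuallyLE hle)).resolve_left fun h => hμP (ae_eq_empty.1 h)
    filter_upwards [h.mem_iff] with x hx
    simpa using hx
  have hsub : ∀ᵐ x ∂μ, x ∈ ⋃ i ∈ Finset.range n, T^[i] ⁻¹' C := by
    filter_upwards [hPinv, hT.ae_exists_iterate_mem hC hμC] with x hxP ⟨k, hk⟩
    refine Set.mem_iUnion₂.2 ⟨k % n, Finset.mem_range.2 (Nat.mod_lt _ (Nat.pos_of_ne_zero hn)), ?_⟩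
    have : Function.IsPeriodicPt T n x := hxP
    simpa [this.iterate_mod_apply] using hk
  have h1 : μ (⋃ i ∈ Finset.range n, T^[i] ⁻¹' C) = 1 := 
    (measure_congr (Filter.eventuallyEq_univ.2 hsub)).trans measure_univ
  have h2 : μ (⋃ i ∈ Finset.range n, T^[i] ⁻¹' C) ≤ n * μ C := by
    refine (measure_biUnion_finset_le _ _).trans ?_
    simp [(hT.toMeasurePreserving.iterate _).measure_preimage hC.nullMeasurableSet]
  rw [h1] at h2
  have h3 : (n : ENNReal) * μ C < n * (n : ENNReal)⁻¹ :=
    (ENNReal.mul_lt_mul_iff_right (by simpa using hn) (by simp)).2 hCn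
  rw [ENNReal.mul_inv_cancel (by simpa using hn) (by simp)] at h3
  exact absurd h2 (not_le.2 h3)

theorem Ergodic.exists_small_disjoint_preimages [StandardBorelSpace X] [IsProbabilityMeasure μ]
    [NullSingletonClass μ] (hT : Ergodic T μ) (K : ℕ) {δ : ENNReal} (hδ : δ ≠ 0) :
    ∃ D, MeasurableSet D ∧ μ D ≠ 0 ∧ μ D < δ ∧
      ∀ i, i ≠ 0 → i ≤ K → Disjoint D (T^[i] ⁻¹' D) := by
  obtain ⟨D, -, h1, h2, h3, h4⟩ := exists_small_measurableSet_disjoint_preimage (μ := μ)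
    (Finset.Icc 1 K) (fun i => T^[i]) (fun i => hT.measurable.iterate i)
    MeasurableSet.univ (by simp) ((ae_ball_iff (Finset.countable_toSet _)).2
      fun i hi => hT.ae_iterate_ne (by simp at hi; lia)) hδ
  exact ⟨D, h1, h2, h3, fun i h0 hK => h4 i (by simp; lia)⟩

theorem measurable_hitTime (hT : Measurable T) (hD : MeasurableSet D) (N : ℕ) :
    Measurable (hitTime T D N) := by
  refine measurable_of_Iic fun k => ?_
  have : hitTime T D N ⁻¹' Set.Iic k = ⋃ i ∈ Set.Iic k, {x | T^[i] x ∈ D ∨ i = N + 1} := by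
    ext x
    simp only [Set.mem_preimage, Set.mem_Iic, Set.mem_iUnion, Set.mem_ofPred_eq, exists_prop]
    exact ⟨fun h => ⟨_, h, hitTime_spec⟩, fun ⟨i, hi, h⟩ => (Nat.sInf_le h).trans hi⟩
  rw [this]
  refine MeasurableSet.biUnion (Set.to_countable _) fun i _ => ?_
  exact ((hT.iterate i) hD).union (MeasurableSet.const (i = N + 1))

theorem MeasureTheory.MeasurePreserving.measureReal_hitTime_le [IsFiniteMeasure μ]
    (hT : MeasurePreserving T μ μ) (hD : MeasurableSet D) {k : ℕ} (hk : k ≤ N) :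
    μ.real {x | hitTime T D N x ≤ k} ≤ (k + 1) * μ.real D := by
  have : {x | hitTime T D N x ≤ k} ⊆ ⋃ i ∈ Finset.range (k + 1), T^[i] ⁻¹' D := fun x hx =>
    Set.mem_iUnion₂.2 ⟨hitTime T D N x, by simpa [Nat.lt_succ_iff] using hx,
      iterate_hitTime_mem (hx.trans hk)⟩
  refine (measureReal_mono this (measure_ne_top _ _)).trans
    ((measureReal_biUnion_finset_le _ _).trans ?_)
  simp [measureReal_def, (hT.iterate _).measure_preimage hD.nullMeasurableSet]

theorem Ergodic.exists_measure_lt_hitTime_lt [IsFiniteMeasure μ] (hT : Ergodic T μ)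
    (hD : MeasurableSet D) (hμD : μ D ≠ 0) {ε : ENNReal} (hε : ε ≠ 0) (d : ℕ) :
    ∃ N, d ≤ N ∧ μ {x | N < hitTime T D N x} < ε := by
  let S : ℕ → Set X := fun N => ⋂ i ∈ Set.Iic N, (T^[i] ⁻¹' D)ᶜ
  have hS : Antitone S := fun a b hab => Set.biInter_subset_biInter_left (Set.Iic_subset_Iic.2 hab)
  have hSm : ∀ N, MeasurableSet (S N) := fun N =>
    MeasurableSet.biInter (Set.to_countable _) fun i _ => ((hT.measurable.iterate i) hD).compl
  have h0 : μ (⋂ N, S N) = 0 := by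
    have := hT.ae_exists_iterate_mem hD hμD
    rw [ae_iff] at this
    refine measure_mono_null (fun x hx => ?_) this
    simp only [S, Set.mem_iInter, Set.mem_ofPred_eq, not_exists] at hx ⊢
    exact fun n => hx n n Set.self_mem_Iic
  have hlim := tendsto_measure_iInter_atTop (μ := μ) (fun N => (hSm N).nullMeasurableSet) hS
    ⟨0, measure_ne_top _ _⟩
  rw [h0] at hlim
  obtain ⟨N, hN, hdN⟩ := ((hlim.eventually_lt_const (pos_iff_ne_zero.2 hε)).and
    (Filter.eventually_ge_atTop d)).exists
  refine ⟨N, hdN, (measure_mono fun x hx => ?_).trans_lt hN⟩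
  simp only [S, Set.mem_iInter, Set.mem_compl_iff, Set.mem_preimage]
  intro i hi hiD
  have hi : i ≤ N := hi
  have hx : N < hitTime T D N x := hx
  exact absurd (hitTime_le_of_mem (N := N) hiD) (by lia)

end Ergodic

/-! ### Bounded multipliers and series along orbits -/

section Multipliers

variable {ι : Type*} [Nonempty ι] {Z : Type u} [NormedAddCommGroup Z] [NormedSpace ℂ Z]

theorem sum_abs_le_of_forall_subset {ι : Type*} {t : Finset ι} {r : ι → ℝ} {δ : ℝ}
    (h : ∀ t' ⊆ t, |∑ n ∈ t', r n| ≤ δ) : ∑ n ∈ t, |r n| ≤ 2 * δ := by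
  have h1 := h _ (Finset.filter_subset (fun n => 0 ≤ r n) t)
  have h2 := h _ (Finset.filter_subset (fun n => ¬ 0 ≤ r n) t)
  rw [← Finset.sum_filter_add_sum_filter_not t (fun n => 0 ≤ r n),
    Finset.sum_congr rfl (g := r) fun n hn => abs_of_nonneg (Finset.mem_filter.1 hn).2,
    Finset.sum_congr (s₂ := t.filter fun n => ¬ 0 ≤ r n) rfl (g := fun n => -r n)
      fun n hn => abs_of_neg (not_le.1 (Finset.mem_filter.1 hn).2), Finset.sum_neg_distrib]
  linarith [(abs_le.1 h1).2, (abs_le.1 h2).1]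

/-- Scalar multipliers bounded by `C` enlarge the partial sums of a series by at most the factor
`4 * C`: test against a norming functional and split into real and imaginary parts and signs. -/
theorem norm_sum_smul_le_of_forall_subset {t : Finset ι} {y : ι → Z} {a : ι → ℂ} {C δ : ℝ}
    (ha : ∀ n, ‖a n‖ ≤ C) (h : ∀ t' ⊆ t, ‖∑ n ∈ t', y n‖ ≤ δ) :
    ‖∑ n ∈ t, a n • y n‖ ≤ C * (4 * δ) := by
  have hC := (norm_nonneg _).trans (ha (Classical.arbitrary ι))
  obtain ⟨g, hg, hgx⟩ := exists_dual_vector'' ℂ (∑ n ∈ t, a n • y n)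
  have hsub : ∀ t' ⊆ t, ‖∑ n ∈ t', g (y n)‖ ≤ δ := fun t' ht' => by
    rw [← map_sum]
    exact ((g.le_of_opNorm_le hg _).trans (by simp)).trans (h t' ht')
  have hre : ∑ n ∈ t, |(g (y n)).re| ≤ 2 * δ := sum_abs_le_of_forall_subset fun t' ht' => by
    rw [← Complex.re_sum]
    exact (Complex.abs_re_le_norm _).trans (hsub t' ht')
  have him : ∑ n ∈ t, |(g (y n)).im| ≤ 2 * δ := sum_abs_le_of_forall_subset fun t' ht' => by
    rw [← Complex.im_sum]
    exact (Complex.abs_im_le_norm _).trans (hsub t' ht')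
  calc ‖∑ n ∈ t, a n • y n‖ = ‖g (∑ n ∈ t, a n • y n)‖ := by rw [hgx]; simp
    _ = ‖∑ n ∈ t, a n * g (y n)‖ := by simp [map_sum]
    _ ≤ ∑ n ∈ t, C * (|(g (y n)).re| + |(g (y n)).im|) := by
        refine norm_sum_le_of_le _ fun n _ => ?_
        rw [norm_mul]
        exact mul_le_mul (ha n) (Complex.norm_le_abs_re_add_abs_im _) (norm_nonneg _) hC
    _ = C * (∑ n ∈ t, |(g (y n)).re| + ∑ n ∈ t, |(g (y n)).im|) := by
        rw [← Finset.mul_sum, Finset.sum_add_distrib]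
    _ ≤ C * (4 * δ) := by gcongr; linarith

variable [CompleteSpace Z] {y : ι → Z}

theorem Summable.exists_finset_norm_sum_smul_le (hy : Summable y) {ε : ℝ} (hε : 0 < ε) :
    ∃ s : Finset ι, ∀ (C : ℝ) (a : ι → ℂ), (∀ n, ‖a n‖ ≤ C) →
      ∀ t, Disjoint t s → ‖∑ n ∈ t, a n • y n‖ ≤ C * ε := by
  obtain ⟨s, hs⟩ := summable_iff_vanishing_norm.1 hy (ε / 4) (by positivity)
  refine ⟨s, fun C a ha t ht => ?_⟩
  have := norm_sum_smul_le_of_forall_subset (t := t) (y := y) ha (δ := ε / 4) fun t' ht' =>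
    (hs t' (Finset.disjoint_of_subset_left ht' ht)).le
  linarith

theorem Summable.smul_of_forall_norm_le (hy : Summable y) {a : ι → ℂ} {C : ℝ}
    (ha : ∀ n, ‖a n‖ ≤ C) : Summable fun n => a n • y n := by
  refine summable_iff_vanishing_norm.2 fun ε hε => ?_
  obtain ⟨s, hs⟩ := hy.exists_finset_norm_sum_smul_le (ε := ε / (2 * (|C| + 1))) (by positivity)
  refine ⟨s, fun t ht => (hs C a ha t ht).trans_lt ?_⟩
  calc C * (ε / (2 * (|C| + 1))) ≤ (|C| + 1) * (ε / (2 * (|C| + 1))) := by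
        gcongr; linarith [le_abs_self C]
    _ = ε / 2 := by field_simp
    _ < ε := by linarith

theorem Summable.exists_finset_norm_tsum_smul_le (hy : Summable y) {ε : ℝ} (hε : 0 < ε) :
    ∃ s : Finset ι, ∀ (C : ℝ) (a : ι → ℂ), (∀ n, ‖a n‖ ≤ C) →
      (∀ n ∈ s, a n • y n = 0) → ‖∑' n, a n • y n‖ ≤ C * ε := by
  classical
  obtain ⟨s, hs⟩ := hy.exists_finset_norm_sum_smul_le hε
  refine ⟨s, fun C a ha h0 => ?_⟩
  refine le_of_tendsto (hy.smul_of_forall_norm_le ha).hasSum.norm (Filter.Eventually.of_forall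
    fun t => ?_)
  rw [← Finset.sum_sdiff (Finset.inter_subset_left (s₁ := t) (s₂ := s)),
    Finset.sum_eq_zero (s := t ∩ s) fun n hn => h0 n (Finset.mem_inter.1 hn).2, add_zero]
  exact hs C a ha _ (by rw [Finset.sdiff_inter_self_left]; exact Finset.sdiff_disjoint)

theorem Summable.exists_forall_norm_tsum_smul_le (hy : Summable y) :
    ∃ K : ℝ, 0 ≤ K ∧ ∀ (C : ℝ) (a : ι → ℂ), (∀ n, ‖a n‖ ≤ C) → ‖∑' n, a n • y n‖ ≤ C * K := by
  classical
  obtain ⟨s, hs⟩ := hy.exists_finset_norm_sum_smul_le one_pos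
  refine ⟨∑ n ∈ s, ‖y n‖ + 1, by positivity, fun C a ha => ?_⟩
  refine le_of_tendsto (hy.smul_of_forall_norm_le ha).hasSum.norm ?_
  filter_upwards [Filter.eventually_ge_atTop s] with t ht
  rw [← Finset.sum_sdiff ht]
  refine (norm_add_le _ _).trans ?_
  have h1 := hs C a ha (t \ s) Finset.sdiff_disjoint
  have h2 : ‖∑ n ∈ s, a n • y n‖ ≤ C * ∑ n ∈ s, ‖y n‖ := by
    rw [Finset.mul_sum]
    refine norm_sum_le_of_le _ fun n _ => ?_
    rw [norm_smul]
    exact mul_le_mul_of_nonneg_right (ha n) (norm_nonneg _)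
  linarith

end Multipliers

section OrbitSum

variable {X : Type v} {τ : ℤ → X → X}
variable {Z : Type u} [NormedAddCommGroup Z] [NormedSpace ℂ Z] {y : ℤ → Z}

/-- The series `∑ f(τ n x) • y n` along the orbit of `x`. When `A (y (n + 1)) = y n` this intertwines
`T` and `A`. -/
noncomputable def orbitSum (τ : ℤ → X → X) (y : ℤ → Z) (f : X → ℂ) (x : X) : Z :=
  ∑' n, f (τ n x) • y n

theorem orbitSum_sub [CompleteSpace Z] (hy : Summable y) {f g : X → ℂ} {C C' : ℝ} (hC : ∀ x, ‖f x‖ ≤ C)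
    (hC' : ∀ x, ‖g x‖ ≤ C') (x : X) :
    orbitSum τ y f x - orbitSum τ y g x = orbitSum τ y (fun x => f x - g x) x := by
  simp only [orbitSum, sub_smul]
  exact ((hy.smul_of_forall_norm_le fun n => hC (τ n x)).tsum_sub
    (hy.smul_of_forall_norm_le fun n => hC' (τ n x))).symm

end OrbitSum

section OrbitFamily

variable {X : Type v} [MeasurableSpace X] {μ : Measure X} {T : X → X} {τ : ℤ → X → X}
variable {Z : Type u} [NormedAddCommGroup Z] [NormedSpace ℂ Z] {y : ℤ → Z}

/-- `τ n` plays the role of `T ^ n` for the integers `n` in `J`. For negative `n` this is an iterate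
of an inverse of `T`; outside of `J` nothing relates `τ n` to `T` when `n < 0`, so that a
non-invertible `T` also has such a family as soon as `J` consists of natural numbers. -/
structure IsOrbitFamily (μ : Measure X) (T : X → X) (τ : ℤ → X → X) (J : Set ℤ) : Prop where
  measurePreserving : ∀ n, MeasurePreserving (τ n) μ μ
  natCast : ∀ n : ℕ, τ n = T^[n]
  map_apply : ∀ n ∈ J, ∀ᵐ x ∂μ, T (τ n x) = τ (n + 1) x
  apply_map : ∀ n ∈ J, ∀ᵐ x ∂μ, τ n (T x) = τ (n + 1) x

variable [CompleteSpace Z]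

theorem stronglyMeasurable_orbitSum (hy : Summable y) (hτ : ∀ n, Measurable (τ n)) {f : X → ℂ}
    (hf : Measurable f) {C : ℝ} (hC : ∀ x, ‖f x‖ ≤ C) : StronglyMeasurable (orbitSum τ y f) := by
  refine stronglyMeasurable_of_tendsto (f := fun (s : Finset ℤ) x => ∑ n ∈ s, f (τ n x) • y n)
    Filter.atTop (fun s => Finset.stronglyMeasurable_fun_sum s fun n _ =>
      ((hf.comp (hτ n)).stronglyMeasurable).smul_const _) (tendsto_pi_nhds.2 fun x => ?_)
  exact (hy.smul_of_forall_norm_le fun n => hC (τ n x)).hasSum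

theorem integrable_orbitSum [IsFiniteMeasure μ] (hy : Summable y) (hτ : ∀ n, Measurable (τ n))
    {f : X → ℂ} (hf : Measurable f) {C : ℝ} (hC : ∀ x, ‖f x‖ ≤ C) :
    Integrable (orbitSum τ y f) μ := by
  obtain ⟨K, -, hK⟩ := hy.exists_forall_norm_tsum_smul_le
  exact Integrable.of_bound (stronglyMeasurable_orbitSum hy hτ hf hC).aestronglyMeasurable (C * K)
    (Filter.Eventually.of_forall fun x => hK C _ fun n => hC (τ n x))

/-- If `h` vanishes outside of `F`, then its orbit series is controlled by the tail of `∑ y n` except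
where one of the first few iterates meets `F`. -/
theorem integral_norm_orbitSum_le [IsProbabilityMeasure μ] (hy : Summable y)
    (hτ : ∀ n, MeasurePreserving (τ n) μ μ) {ε : ℝ} (hε : 0 < ε) :
    ∃ K : ℝ, 0 ≤ K ∧ ∀ (C : ℝ) (h : X → ℂ) (F : Set X), 0 ≤ C → Measurable h → (∀ x, ‖h x‖ ≤ C) →
      MeasurableSet F → (∀ x ∉ F, h x = 0) →
      ∫ x, ‖orbitSum τ y h x‖ ∂μ ≤ C * ε + C * K * μ.real F := by
  obtain ⟨K, hK0, hK⟩ := hy.exists_forall_norm_tsum_smul_le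
  obtain ⟨s, hs⟩ := hy.exists_finset_norm_tsum_smul_le hε
  refine ⟨K * s.card, by positivity, fun C h F hC0 hh hC hF h0 => ?_⟩
  have hpt : ∀ x, ‖orbitSum τ y h x‖ ≤
      C * ε + C * K * ∑ n ∈ s, (τ n ⁻¹' F).indicator (fun _ => (1 : ℝ)) x := by
    intro x
    have hnn : ∀ n ∈ s, (0 : ℝ) ≤ (τ n ⁻¹' F).indicator (fun _ => (1 : ℝ)) x := fun n _ =>
      Set.indicator_nonneg (fun _ _ => zero_le_one) x
    by_cases hx : ∃ n ∈ s, τ n x ∈ F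
    · obtain ⟨n, hn, hnF⟩ := hx
      have h1 : (1 : ℝ) ≤ ∑ n ∈ s, (τ n ⁻¹' F).indicator (fun _ => (1 : ℝ)) x := by
        refine le_trans ?_ (Finset.single_le_sum hnn hn)
        rw [Set.indicator_of_mem (by exact hnF)]
      have h2 : ‖orbitSum τ y h x‖ ≤ C * K := hK C _ fun n => hC (τ n x)
      nlinarith [mul_nonneg hC0 hK0, mul_nonneg hC0 hε.le]
    · push Not at hx
      have h2 : ‖orbitSum τ y h x‖ ≤ C * ε := hs C _ (fun n => hC (τ n x)) fun n hn => by
        rw [h0 _ (hx n hn), zero_smul]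
      nlinarith [mul_nonneg (mul_nonneg hC0 hK0) (Finset.sum_nonneg hnn)]
  have hint : ∀ n ∈ s, Integrable (fun x => (τ n ⁻¹' F).indicator (fun _ => (1 : ℝ)) x) μ :=
    fun n _ => (integrable_const 1).indicator ((hτ n).measurable hF)
  calc ∫ x, ‖orbitSum τ y h x‖ ∂μ
      ≤ ∫ x, (C * ε + C * K * ∑ n ∈ s, (τ n ⁻¹' F).indicator (fun _ => (1 : ℝ)) x) ∂μ :=
        integral_mono (integrable_orbitSum hy (fun n => (hτ n).measurable) hh hC).norm
          ((integrable_const _).add ((integrable_finsetSum _ hint).const_mul _)) hpt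
    _ = C * ε + C * (K * s.card) * μ.real F := by
        rw [integral_add (integrable_const _) ((integrable_finsetSum _ hint).const_mul _),
          integral_const_mul (C * K), integral_finsetSum _ hint]
        simp only [integral_const, probReal_univ, one_smul]
        rw [Finset.sum_congr rfl (g := fun _ => μ.real F)]
        · simp; ring
        · intro n _
          rw [integral_indicator_const _ ((hτ n).measurable hF), smul_eq_mul, mul_one,
            measureReal_def, (hτ n).measure_preimage hF.nullMeasurableSet, measureReal_def]

theorem ae_orbitSum_map (hy : Summable y) {A : Z →L[ℂ] Z} (hA : ∀ n, A (y (n + 1)) = y n)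
    (hτ : IsOrbitFamily μ T τ (Function.support y)) {f : X → ℂ} {C : ℝ} (hC : ∀ x, ‖f x‖ ≤ C) :
    ∀ᵐ x ∂μ, A (orbitSum τ y f x) = orbitSum τ y f (T x) := by
  have : ∀ᵐ x ∂μ, ∀ n, y n ≠ 0 → τ n (T x) = τ (n + 1) x := by
    refine ae_all_iff.2 fun n => ?_
    by_cases hn : y n = 0
    · simp [hn]
    · filter_upwards [hτ.apply_map n hn] with x hx _ using hx
  filter_upwards [this] with x hx
  have h1 : Summable fun n => f (τ n x) • y n := hy.smul_of_forall_norm_le fun n => hC (τ n x)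
  rw [orbitSum, A.map_tsum h1, ← (Equiv.addRight (1 : ℤ)).tsum_eq, orbitSum]
  refine tsum_congr fun n => ?_
  by_cases hn : y n = 0
  · simp [hA, hn]
  · simp [hA, hx n hn]

end OrbitFamily

/-! ### Perturbing simple functions -/

theorem hitTime_eq_of_disjoint {X : Type v} {T : X → X} {D : Set X} {N p : ℕ} {x : X} (hpN : p ≤ N)
    (hD : ∀ i, i ≠ 0 → i ≤ N → Disjoint D (T^[i] ⁻¹' D)) (hx : T^[p] x ∈ D) :
    hitTime T D N x = p := by
  have h1 : hitTime T D N x ≤ p := hitTime_le_of_mem hx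
  by_contra hne
  have h2 : T^[hitTime T D N x] x ∈ D := iterate_hitTime_mem (h1.trans hpN)
  refine Set.disjoint_left.1 (hD (p - hitTime T D N x) (by lia) (by lia)) h2 ?_
  rwa [Set.mem_preimage, ← Function.iterate_add_apply, Nat.sub_add_cancel h1]

section Approximation

variable {X : Type v} [MeasurableSpace X] {μ : Measure X} {T : X → X} {τ : ℤ → X → X}
variable {Z : Type u} [NormedAddCommGroup Z] [NormedSpace ℂ Z] {y : ℤ → Z}

theorem IsOrbitFamily.ae_iterate_apply {J : Set ℤ} (hτ : IsOrbitFamily μ T τ J)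
    (hJ : ∀ n ∈ J, n + 1 ∈ J) :
    ∀ᵐ x ∂μ, ∀ n ∈ J, ∀ k : ℕ, T^[k] (τ n x) = τ (n + k) x := by
  have h : ∀ᵐ x ∂μ, ∀ n : ℤ, n ∈ J → T (τ n x) = τ (n + 1) x := by
    refine ae_all_iff.2 fun n => ?_
    by_cases hn : n ∈ J
    · filter_upwards [hτ.map_apply n hn] with x hx _ using hx
    · simp [hn]
  filter_upwards [h] with x hx n hn k
  have hJk : ∀ k : ℕ, n + k ∈ J := fun k => by
    induction k with
    | zero => simpa using hn
    | succ k ih => simpa [add_assoc] using hJ _ ih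
  induction k with
  | zero => simp
  | succ k ih => rw [Function.iterate_succ_apply', ih, hx _ (hJk k)]; push_cast; rw [add_assoc]

variable [CompleteSpace Z]

/-- A simple function can be changed on a small set so that its orbit series visits a given open
set: over a small base `D` with many disjoint preimages, prescribe the values along the tower to be
the coefficients of a finite combination of the vectors `y n`. -/
theorem exists_simpleFunc_orbitSum_mem_open [StandardBorelSpace X] [IsProbabilityMeasure μ]
    [NullSingletonClass μ] (hT : Ergodic T μ) (hy : Summable y)
    (hτ : IsOrbitFamily μ T τ (Function.support y)) (hJ : ∀ n, y n ≠ 0 → y (n + 1) ≠ 0)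
    (f : SimpleFunc X ℂ) {η : ℝ} (hη : 0 < η) {U : Set Z} (hU : IsOpen U)
    {z : Z} (hzU : z ∈ U) (hz : z ∈ Submodule.span ℂ (Set.range y)) :
    ∃ f' : SimpleFunc X ℂ, ∫ x, ‖f' x - f x‖ ∂μ < η ∧
      ∫ x, ‖orbitSum τ y f' x - orbitSum τ y f x‖ ∂μ < η ∧ μ {x | orbitSum τ y f' x ∈ U} ≠ 0 := by
  obtain ⟨a, rfl⟩ := Finsupp.mem_span_range_iff_exists_finsupp.1 hz
  obtain ⟨ε, hε, hεU⟩ := Metric.isOpen_iff.1 hU _ hzU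
  obtain ⟨C₁, hC₁⟩ := f.exists_forall_norm_le
  obtain ⟨C₂, hC₂⟩ : ∃ C₂, ∀ n, ‖a n‖ ≤ C₂ := by
    obtain ⟨C₂, h⟩ := (a.finite_range.image norm).bddAbove
    exact ⟨C₂, fun n => h ⟨a n, ⟨n, rfl⟩, rfl⟩⟩
  obtain ⟨C, hC, hfC, haC⟩ : ∃ C : ℝ, 0 < C ∧ (∀ x, ‖f x‖ ≤ C) ∧ ∀ n, ‖a n‖ ≤ C :=
    ⟨max (max C₁ C₂) 1, by positivity, fun x => (hC₁ x).trans (by simp),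
      fun n => (hC₂ n).trans (by simp)⟩
  obtain ⟨s, hs⟩ := hy.exists_finset_norm_tsum_smul_le (ε := ε / (4 * C)) (by positivity)
  obtain ⟨K, hK0, hK⟩ := integral_norm_orbitSum_le hy hτ.measurePreserving (ε := η / (4 * C))
    (by positivity)
  let M : ℕ := s.sup Int.natAbs
  obtain ⟨D, hD, hμD, hDδ, hdisj⟩ := hT.exists_small_disjoint_preimages (2 * M)
    (δ := ENNReal.ofReal (η / (4 * C * (K + 1)) / (2 * M + 1)))
    (by simp only [ne_eq, ENNReal.ofReal_eq_zero, not_le]; positivity)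
  have hhit := measurable_hitTime hT.measurable hD (2 * M)
  let F : Set X := {x | hitTime T D (2 * M) x ≤ 2 * M}
  have hF : MeasurableSet F := hhit measurableSet_Iic
  have hμF : μ.real F < η / (4 * C * (K + 1)) := by
    have h2 : μ.real F ≤ (2 * M + 1) * μ.real D := by
      simpa using hT.toMeasurePreserving.measureReal_hitTime_le hD (N := 2 * M) le_rfl
    have h3 : μ.real D < η / (4 * C * (K + 1)) / (2 * M + 1) :=
      (ENNReal.lt_ofReal_iff_toReal_lt (measure_ne_top _ _)).1 hDδ
    rw [lt_div_iff₀ (by positivity)] at h3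
    linarith
  classical
  -- A point `x` with `T^[M] x ∈ D` is in the middle of the tower: the hitting time of `τ n x` is `M - n`.
  let g : X → ℂ := fun x => if x ∈ F then a (M - hitTime T D (2 * M) x) else f x
  have hg : Measurable g := Measurable.ite hF
    ((measurable_from_top (f := fun k : ℕ => a (M - k))).comp hhit) f.measurable
  have hgfin : (Set.range g).Finite := by
    refine (a.finite_range.union f.finite_range).subset ?_
    rintro _ ⟨x, rfl⟩
    by_cases hx : x ∈ F
    · exact Or.inl ⟨_, (if_pos hx).symm⟩
    · exact Or.inr ⟨x, (if_neg hx).symm⟩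
  let f' : SimpleFunc X ℂ := ⟨g, fun c => hg (measurableSet_singleton c), hgfin⟩
  have hgC : ∀ x, ‖f' x‖ ≤ C := fun x => by
    change ‖ite _ _ _‖ ≤ C
    split_ifs
    · exact haC _
    · exact hfC x
  have hhC : ∀ x, ‖f' x - f x‖ ≤ 2 * C := fun x =>
    (norm_sub_le _ _).trans (by linarith [hgC x, hfC x])
  have hh0 : ∀ x ∉ F, f' x - f x = 0 := fun x hx => sub_eq_zero.2 (if_neg hx)
  refine ⟨f', ?_, ?_, ?_⟩
  · calc ∫ x, ‖f' x - f x‖ ∂μ ≤ ∫ x, F.indicator (fun _ => 2 * C) x ∂μ := by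
          refine integral_mono_of_nonneg (Filter.Eventually.of_forall fun _ => norm_nonneg _)
            ((integrable_const _).indicator hF) (Filter.Eventually.of_forall fun x => ?_)
          by_cases hx : x ∈ F
          · simpa [hx] using hhC x
          · simp [hx, hh0 x hx]
      _ = μ.real F * (2 * C) := by rw [integral_indicator_const _ hF, smul_eq_mul]
      _ < η := by
          rw [lt_div_iff₀ (by positivity)] at hμF
          nlinarith [mul_nonneg (mul_nonneg (measureReal_nonneg (μ := μ) (s := F)) hC.le) hK0,
            mul_nonneg (measureReal_nonneg (μ := μ) (s := F)) hC.le]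
  · simp only [orbitSum_sub hy hgC hfC]
    refine (hK (2 * C) _ F (by positivity) (f'.measurable.sub f.measurable) hhC hF hh0).trans_lt ?_
    rw [lt_div_iff₀ (by positivity)] at hμF
    have : 2 * C * (η / (4 * C)) = η / 2 := by field_simp; norm_num
    nlinarith [mul_nonneg (measureReal_nonneg (μ := μ) (s := F)) hC.le]
  · have hB : μ (T^[M] ⁻¹' D) ≠ 0 := by
      rwa [(hT.toMeasurePreserving.iterate M).measure_preimage hD.nullMeasurableSet]
    refine fun h0 => hB (measure_mono_null_ae (t := {x | orbitSum τ y f' x ∈ U}) ?_ h0)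
    filter_upwards [hτ.ae_iterate_apply hJ] with x hx hxB
    refine hεU ?_
    have hsum : (a.sum fun n c => c • y n) = ∑' n, a n • y n :=
      (tsum_eq_sum (fun n hn => by simp [Finsupp.notMem_support_iff.1 hn])).symm
    have hval : ∀ n ∈ s, (f' (τ n x) - a n) • y n = 0 := by
      intro n hn
      by_cases hyn : y n = 0
      · simp [hyn]
      have hnM : n.natAbs ≤ M := Finset.le_sup (f := Int.natAbs) hn
      obtain ⟨p, hp⟩ : ∃ p : ℕ, (p : ℤ) = M - n := ⟨(M - n).toNat, by lia⟩
      have h1 : T^[p] (τ n x) ∈ D := by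
        rw [hx n hyn p, hp, add_sub_cancel, hτ.natCast]
        exact hxB
      have h2 := hitTime_eq_of_disjoint (N := 2 * M) (by lia) hdisj h1
      have h3 : f' (τ n x) = a n := by
        change ite _ _ _ = _
        rw [if_pos (show τ n x ∈ F from h2.le.trans (by lia)), h2, hp, sub_sub_cancel]
      rw [h3, sub_self, zero_smul]
    rw [Metric.mem_ball, dist_eq_norm, hsum, orbitSum,
      ← (hy.smul_of_forall_norm_le fun n => hgC (τ n x)).tsum_sub (hy.smul_of_forall_norm_le haC)]
    simp only [← sub_smul]
    refine (hs (2 * C) _ (fun n => (norm_sub_le _ _).trans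
      (by linarith [hgC (τ n x), haC n])) hval).trans_lt ?_
    have : 2 * C * (ε / (4 * C)) = ε / 2 := by field_simp; norm_num
    linarith

theorem exists_lipschitz_separating {V W : Set ℂ} (hV : V.Finite) (hW : W.Finite)
    (hVW : Disjoint V W) : ∃ (φ : ℂ → ℝ) (K : NNReal), LipschitzWith K φ ∧ (∀ z, 0 ≤ φ z) ∧
      (∀ z, φ z ≤ 1) ∧ (∀ z ∈ V, φ z = 0) ∧ ∀ z ∈ W, φ z = 1 := by
  -- An extra point keeps the closed set non-empty, so that its distance function is not junk.
  obtain ⟨w, hw⟩ := hW.infinite_compl.nonempty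
  have hVc : IsClosed (insert w V) := (hV.insert w).isClosed
  have hpos : ∀ z ∈ W, 0 < Metric.infDist z (insert w V) := fun z hz =>
    (hVc.notMem_iff_infDist_pos ⟨w, Set.mem_insert _ _⟩).1 (by
      rintro (rfl | h)
      · exact hw hz
      · exact Set.disjoint_left.1 hVW h hz)
  obtain ⟨r, hr, hrW⟩ : ∃ r : ℝ, 0 < r ∧ ∀ z ∈ W, r ≤ Metric.infDist z (insert w V) := by
    rcases W.eq_empty_or_nonempty with rfl | hne
    · exact ⟨1, one_pos, by simp⟩
    · obtain ⟨z, hz, hmin⟩ := hW.exists_minimalFor (fun z => Metric.infDist z (insert w V)) _ hne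
      exact ⟨_, hpos z hz, fun z' hz' => (le_total _ _).elim id fun h => hmin hz' h⟩
  refine ⟨fun z => min 1 (r⁻¹ * Metric.infDist z (insert w V)), _,
    ((lipschitzWith_iff_norm_sub_le.2 fun x x' => ?_ :
      LipschitzWith (Real.toNNReal r⁻¹) fun x : ℝ => r⁻¹ * x).comp
      (Metric.lipschitz_infDist_pt _)).const_min 1, fun z => ?_, fun z => min_le_left _ _, ?_, ?_⟩
  · rw [← mul_sub, norm_mul, Real.coe_toNNReal _ (by positivity),
      Real.norm_of_nonneg (by positivity)]
  · exact le_min zero_le_one (mul_nonneg (by positivity) Metric.infDist_nonneg)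
  · intro z hz
    simp [Metric.infDist_zero_of_mem (Set.mem_insert_of_mem w hz)]
  · intro z hz
    refine min_eq_left ?_
    rw [← div_eq_inv_mul, le_div_iff₀ hr, one_mul]
    exact hrW z hz

theorem exists_small_eval_injOn {S : Set (Polynomial ℂ)} (hS : S.Finite) {δ : ℝ} (hδ : 0 < δ) :
    ∃ t ∈ Set.Ioo 0 δ, Set.InjOn (fun P => P.eval (t : ℂ)) S := by
  let R : Set ℂ := ⋃ p ∈ S ×ˢ S, {c | c ∈ (p.1 - p.2).roots}
  have hR : R.Finite := (hS.prod hS).biUnion fun p _ => Multiset.finite_toSet _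
  obtain ⟨t, ht, htR⟩ := (Set.Ioo_infinite hδ).exists_notMem_finite
    (hR.preimage (f := ((↑) : ℝ → ℂ)) Complex.ofReal_injective.injOn)
  refine ⟨t, ht, fun P hP Q hQ hPQ => ?_⟩
  by_contra hne
  refine htR (Set.mem_iUnion₂.2 ⟨(P, Q), ⟨hP, hQ⟩, ?_⟩)
  change (t : ℂ) ∈ (P - Q).roots
  rw [Polynomial.mem_roots (sub_ne_zero.2 hne), Polynomial.IsRoot, Polynomial.eval_sub]
  exact sub_eq_zero.2 hPQ

/-- A simple function `f` can be perturbed uniformly little so that the values of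
`∑ q k * f(T^k x)` almost decide whether `x ∈ B`. Let `n` be the time that `x` needs to reach a small
set, and add to `f x` a small `t ^ m` whose exponent `m = 2 n + 1` or `m = 2 n + 2` encodes `n` and
the indicator of `B`. As `n` decreases along the orbit, the sum is a polynomial in `t` of
degree exactly `m`, and generic `t` tells finitely many polynomials apart. -/
theorem exists_simpleFunc_separating [IsProbabilityMeasure μ] (hT : Ergodic T μ)
    (hsmall : ∀ δ : ENNReal, δ ≠ 0 → ∃ D, MeasurableSet D ∧ μ D ≠ 0 ∧ μ D < δ)
    (hy : Summable y) (f : SimpleFunc X ℂ) {η : ℝ} (hη : 0 < η)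
    {B : Set X} (hB : MeasurableSet B) {q : ℕ → ℂ} (hq : q 0 ≠ 0) (d : ℕ) {ε : ℝ} (hε : 0 < ε) :
    ∃ f' : SimpleFunc X ℂ, ∫ x, ‖f' x - f x‖ ∂μ < η ∧
      ∫ x, ‖orbitSum τ y f' x - orbitSum τ y f x‖ ∂μ < η ∧
      ∃ (φ : ℂ → ℝ) (K : NNReal), LipschitzWith K φ ∧
        ∫ x, |φ (∑ k ∈ Finset.range (d + 1), q k * f' (T^[k] x)) - B.indicator 1 x| ∂μ < ε := by
  classical
  obtain ⟨C₁, hC₁⟩ := f.exists_forall_norm_le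
  obtain ⟨K, hK0, hK⟩ := hy.exists_forall_norm_tsum_smul_le
  obtain ⟨D, hD, hμD, hDδ⟩ := hsmall (ENNReal.ofReal (ε / 2 / (d + 1)))
    (by simp only [ne_eq, ENNReal.ofReal_eq_zero, not_le]; positivity)
  obtain ⟨N, hdN, hN⟩ := hT.exists_measure_lt_hitTime_lt hD hμD (ε := ENNReal.ofReal (ε / 2))
    (by simp only [ne_eq, ENNReal.ofReal_eq_zero, not_le]; positivity) d
  have hhit := measurable_hitTime hT.measurable hD N
  let e : X → ℕ := B.indicator 1
  have he : Measurable e := measurable_one.indicator hB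
  have he1 : ∀ x, e x ≤ 1 := fun x => by by_cases hx : x ∈ B <;> simp [e, hx]
  let h : X → Polynomial ℂ := fun x =>
    if hitTime T D N x ≤ N then Polynomial.X ^ (2 * hitTime T D N x + e x + 1) else 0
  let ψ : X → Polynomial ℂ := fun x => Polynomial.C (f x) + h x
  let P : X → Polynomial ℂ := fun x =>
    ∑ k ∈ Finset.range (d + 1), Polynomial.C (q k) * ψ (T^[k] x)
  have hhfin : (Set.range h).Finite := by
    refine (((Set.finite_Iic (2 * N + 2)).image fun m => (Polynomial.X ^ m : Polynomial ℂ)).insert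
      0).subset ?_
    rintro _ ⟨x, rfl⟩
    by_cases hx : hitTime T D N x ≤ N
    · refine Or.inr ⟨2 * hitTime T D N x + e x + 1, ?_, (if_pos hx).symm⟩
      have := he1 x
      simp only [Set.mem_Iic]
      lia
    · exact Or.inl (if_neg hx)
  have hψfin : (Set.range ψ).Finite := by
    refine (f.finite_range.image2 (fun c p => Polynomial.C c + p) hhfin).subset ?_
    rintro _ ⟨x, rfl⟩
    exact ⟨_, ⟨x, rfl⟩, _, ⟨x, rfl⟩, rfl⟩
  have hPfin : (Set.range P).Finite := by
    refine ((Set.Finite.pi' (ι := Fin (d + 1)) fun _ => hψfin).image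
      fun w => ∑ k : Fin (d + 1), Polynomial.C (q k) * w k).subset ?_
    rintro _ ⟨x, rfl⟩
    refine ⟨fun k => ψ (T^[k] x), fun k => ⟨_, rfl⟩, ?_⟩
    exact (Finset.sum_range fun k => Polynomial.C (q k) * ψ (T^[k] x)).symm
  -- The term `k = 0` has degree at least `2 n + 1`, all others have degree at most `2 (n - 1) + 2`.
  have hdeg : ∀ x, d ≤ hitTime T D N x → hitTime T D N x ≤ N →
      (P x).natDegree = 2 * hitTime T D N x + e x + 1 := by
    intro x hdx hxN
    have h0 : (Polynomial.C (q 0) * ψ (T^[0] x)).natDegree = 2 * hitTime T D N x + e x + 1 := by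
      rw [Polynomial.natDegree_C_mul hq]
      simp only [ψ, h, Function.iterate_zero, id_eq, if_pos hxN]
      rw [add_comm, Polynomial.natDegree_X_pow_add_C]
    simp only [P, Finset.sum_range_succ']
    rw [Polynomial.natDegree_add_eq_right_of_natDegree_lt, h0]
    rw [h0]
    refine (Polynomial.natDegree_sum_le_of_forall_le _ _ (n := 2 * hitTime T D N x)
      fun k hk => ?_).trans_lt (by lia)
    have hkd : k + 1 ≤ d := Finset.mem_range.1 hk
    refine (Polynomial.natDegree_C_mul_le _ _).trans ?_
    have hk' := hitTime_iterate hxN (hkd.trans hdx)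
    have := he1 (T^[k + 1] x)
    simp only [ψ, h, hk', if_pos (show hitTime T D N x - (k + 1) ≤ N by lia)]
    rw [add_comm, Polynomial.natDegree_X_pow_add_C]
    lia
  obtain ⟨t, ⟨ht0, ht⟩, htinj⟩ := exists_small_eval_injOn hPfin
    (δ := min 1 (η / (K + 1))) (by positivity)
  have ht1 : t < 1 := ht.trans_le (min_le_left _ _)
  have htη : t * (K + 1) < η := by
    rw [← lt_div_iff₀ (by positivity)]
    exact ht.trans_le (min_le_right _ _)
  have hheval : ∀ x, (h x).eval (t : ℂ) =
      if hitTime T D N x ≤ N then (t : ℂ) ^ (2 * hitTime T D N x + e x + 1) else 0 := fun x => by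
    by_cases hx : hitTime T D N x ≤ N <;> simp [h, hx]
  let g : X → ℂ := fun x => (ψ x).eval (t : ℂ)
  have hgf : ∀ x, g x = f x + (h x).eval (t : ℂ) := fun x => by simp [g, ψ]
  have hg : Measurable g := by
    simp only [funext hgf, hheval]
    refine f.measurable.add (Measurable.ite (hhit measurableSet_Iic) ?_ measurable_const)
    exact (measurable_from_top (f := fun m : ℕ => (t : ℂ) ^ m)).comp
      (((hhit.const_mul 2).add he).add_const 1)
  let f' : SimpleFunc X ℂ := ⟨g, fun c => hg (measurableSet_singleton c),
    (hψfin.image fun p => p.eval (t : ℂ)).subset (by rintro _ ⟨x, rfl⟩; exact ⟨_, ⟨x, rfl⟩, rfl⟩)⟩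
  have hf'f : ∀ x, ‖f' x - f x‖ ≤ t := fun x => by
    change ‖g x - f x‖ ≤ t
    rw [hgf, add_sub_cancel_left, hheval]
    split_ifs
    · rw [norm_pow, Complex.norm_real, Real.norm_of_nonneg ht0.le]
      exact pow_le_of_le_one ht0.le ht1.le (by simp)
    · simpa using ht0.le
  obtain ⟨C₂, hC₂⟩ := f'.exists_forall_norm_le
  refine ⟨f', ?_, ?_, ?_⟩
  · refine (integral_mono_of_nonneg (g := fun _ => t) (Filter.Eventually.of_forall fun _ =>
      norm_nonneg _) (integrable_const _) (Filter.Eventually.of_forall hf'f)).trans_lt ?_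
    simp only [integral_const, probReal_univ, one_smul]
    nlinarith
  · simp only [orbitSum_sub hy hC₂ hC₁]
    refine (integral_mono_of_nonneg (g := fun _ => t * K) (Filter.Eventually.of_forall fun _ =>
      norm_nonneg _) (integrable_const _) (Filter.Eventually.of_forall fun x =>
        hK t _ fun n => hf'f (τ n x))).trans_lt ?_
    simp only [integral_const, probReal_univ, one_smul]
    nlinarith
  · have hdisj : Disjoint
        ((fun p => Polynomial.eval (t : ℂ) p) '' {p ∈ Set.range P | Odd p.natDegree})
        ((fun p => Polynomial.eval (t : ℂ) p) '' {p ∈ Set.range P | Even p.natDegree}) := by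
      rw [Set.disjoint_left]
      rintro _ ⟨p, ⟨hp, hpo⟩, rfl⟩ ⟨p', ⟨hp', hpe⟩, hpp⟩
      rw [htinj hp' hp hpp] at hpe
      exact (Nat.not_even_iff_odd.2 hpo) hpe
    obtain ⟨φ, L, hφ, hφ0, hφ1, hφV, hφW⟩ := exists_lipschitz_separating
      ((hPfin.subset (Set.sep_subset _ _)).image _) ((hPfin.subset (Set.sep_subset _ _)).image _)
      hdisj
    refine ⟨φ, L, hφ, ?_⟩
    have hval : ∀ x, ∑ k ∈ Finset.range (d + 1), q k * f' (T^[k] x) = (P x).eval (t : ℂ) :=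
      fun x => by simp only [P, Polynomial.eval_finsetSum, Polynomial.eval_mul,
        Polynomial.eval_C]; rfl
    -- Nothing is known about the few points which enter `D` too early or too late.
    let S : Set X := {x | hitTime T D N x ≤ d} ∪ {x | N < hitTime T D N x}
    have hS : MeasurableSet S := (hhit measurableSet_Iic).union (hhit measurableSet_Ioi)
    have hbound : ∀ x, |φ ((P x).eval (t : ℂ)) - B.indicator 1 x| ≤ S.indicator 1 x := by
      intro x
      by_cases hxS : x ∈ S
      · rw [Set.indicator_of_mem hxS, Pi.one_apply, abs_le]
        have h1 : B.indicator (1 : X → ℝ) x ≤ 1 := by by_cases hx : x ∈ B <;> simp [hx]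
        have h2 : 0 ≤ B.indicator (1 : X → ℝ) x := by by_cases hx : x ∈ B <;> simp [hx]
        constructor <;> linarith [hφ0 ((P x).eval (t : ℂ)), hφ1 ((P x).eval (t : ℂ))]
      · have hx : d < hitTime T D N x ∧ hitTime T D N x ≤ N := by
          simpa [S] using hxS
        have hdx := hdeg x hx.1.le hx.2
        rw [Set.indicator_of_notMem hxS]
        by_cases hxB : x ∈ B
        · rw [hφW _ ⟨P x, ⟨⟨x, rfl⟩, ?_⟩, rfl⟩]
          · simp [hxB]
          · rw [hdx]
            simp only [e, Set.indicator_of_mem hxB, Pi.one_apply]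
            exact ⟨hitTime T D N x + 1, by ring⟩
        · rw [hφV _ ⟨P x, ⟨⟨x, rfl⟩, ?_⟩, rfl⟩]
          · simp [hxB]
          · rw [hdx]
            simp only [e, Set.indicator_of_notMem hxB]
            exact ⟨hitTime T D N x, by ring⟩
    simp only [hval]
    refine (integral_mono_of_nonneg (Filter.Eventually.of_forall fun _ => abs_nonneg _)
      ((integrable_const (1 : ℝ)).indicator hS) (Filter.Eventually.of_forall hbound)).trans_lt ?_
    have h1 := hT.toMeasurePreserving.measureReal_hitTime_le hD hdN
    have h2 : μ.real D < ε / 2 / (d + 1) :=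
      (ENNReal.lt_ofReal_iff_toReal_lt (measure_ne_top _ _)).1 hDδ
    have h3 : μ.real {x | N < hitTime T D N x} < ε / 2 :=
      (ENNReal.lt_ofReal_iff_toReal_lt (measure_ne_top _ _)).1 hN
    rw [lt_div_iff₀ (by positivity)] at h2
    rw [integral_indicator_const _ hS, smul_eq_mul, mul_one]
    linarith [measureReal_union_le (μ := μ) {x | hitTime T D N x ≤ d} {x | N < hitTime T D N x}]

end Approximation

/-! ### Baire category, limits in `L¹` and isomorphisms -/

/-- The Baire category theorem in the closure of a set `V`, for open sets which `V` meets
arbitrarily close to each of its points. -/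
theorem exists_mem_closure_forall_mem {E ι : Type*} [PseudoMetricSpace E] [CompleteSpace E]
    [Countable ι] {V : Set E} (hV : V.Nonempty) {O : ι → Set E} (hO : ∀ i, IsOpen (O i))
    (h : ∀ i, ∀ v ∈ V, ∀ η > 0, ∃ v' ∈ V, dist v' v < η ∧ v' ∈ O i) :
    ∃ p ∈ closure V, ∀ i, p ∈ O i := by
  have : CompleteSpace (closure V) := isClosed_closure.completeSpace_coe
  have hdense : ∀ i, Dense ((↑) ⁻¹' O i : Set (closure V)) := by
    refine fun i => Metric.dense_iff.2 fun ⟨p, hp⟩ r hr => ?_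
    obtain ⟨v, hv, hpv⟩ := Metric.mem_closure_iff.1 hp (r / 2) (by positivity)
    obtain ⟨v', hv', hvv', hvO⟩ := h i v hv (r / 2) (by positivity)
    refine ⟨⟨v', subset_closure hv'⟩, ?_, hvO⟩
    rw [Metric.mem_ball, Subtype.dist_eq]
    linarith [dist_triangle v' v p, dist_comm v p]
  obtain ⟨v, hv⟩ := hV
  have : Nonempty (closure V) := ⟨⟨v, subset_closure hv⟩⟩
  obtain ⟨p, hp⟩ := (dense_iInter_of_isOpen (fun i => (hO i).preimage continuous_subtype_val)
    hdense).nonempty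
  exact ⟨p, p.2, fun i => Set.mem_iInter.1 hp i⟩

section Lebesgue

variable {X : Type v} [MeasurableSpace X] {μ : Measure X} {T : X → X}
variable {Z : Type u} [NormedAddCommGroup Z]

theorem dist_toL1_toL1 {f g : X → Z} (hf : Integrable f μ) (hg : Integrable g μ) :
    dist (hf.toL1 f) (hg.toL1 g) = ∫ x, ‖f x - g x‖ ∂μ := by
  rw [dist_eq_norm, ← Integrable.toL1_sub, L1.norm_of_fun_eq_integral_norm]
  rfl

theorem isOpen_setOf_measure_mem_ne_zero {U : Set Z} (hU : IsOpen U) :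
    IsOpen {Φ : X →₁[μ] Z | μ {x | Φ x ∈ U} ≠ 0} := by
  rw [← isClosed_compl_iff, ← isSeqClosed_iff_isClosed]
  intro Φ Φ₀ hΦ hlim
  have hΦ' : ∀ n, ∀ᵐ x ∂μ, Φ n x ∉ U := fun n => by
    rw [ae_iff]
    simpa using hΦ n
  obtain ⟨ns, -, hns⟩ := (tendstoInMeasure_of_tendsto_Lp hlim).exists_seq_tendsto_ae
  have : ∀ᵐ x ∂μ, Φ₀ x ∉ U := by
    filter_upwards [ae_all_iff.2 hΦ', hns] with x hx hlimx
    exact hU.isClosed_compl.mem_of_tendsto hlimx (Filter.Eventually.of_forall fun n => hx (ns n))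
  rw [ae_iff] at this
  simpa using this

theorem LipschitzWith.integrable_comp [IsFiniteMeasure μ] {φ : ℂ → ℝ} {K : NNReal}
    (hφ : LipschitzWith K φ) {g : X → ℂ} (hg : Integrable g μ) :
    Integrable (fun x => φ (g x)) μ := by
  refine ((integrable_const |φ 0|).add (hg.norm.const_mul K)).mono'
    (hφ.continuous.comp_aestronglyMeasurable hg.aestronglyMeasurable)
    (Filter.Eventually.of_forall fun x => ?_)
  have h := hφ.norm_sub_le (g x) 0
  rw [sub_zero] at h
  calc ‖φ (g x)‖ = ‖φ 0 + (φ (g x) - φ 0)‖ := by rw [add_sub_cancel]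
    _ ≤ ‖φ 0‖ + ‖φ (g x) - φ 0‖ := norm_add_le _ _
    _ ≤ |φ 0| + K * ‖g x‖ := by rw [Real.norm_eq_abs (φ 0)]; gcongr

theorem continuous_integral_abs_comp_sub [IsFiniteMeasure μ] {φ : ℂ → ℝ} {K : NNReal}
    (hφ : LipschitzWith K φ) {b : X → ℝ} (hb : Integrable b μ) :
    Continuous fun g : X →₁[μ] ℂ => ∫ x, |φ (g x) - b x| ∂μ := by
  have hint : ∀ g : X →₁[μ] ℂ, Integrable (fun x => |φ (g x) - b x|) μ := fun g =>
    ((hφ.integrable_comp (L1.integrable_coeFn g)).sub hb).abs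
  refine (LipschitzWith.of_le_add_mul K fun g g' => ?_).continuous
  have hgg : Integrable (fun x => K * ‖g x - g' x‖) μ :=
    ((L1.integrable_coeFn g).sub (L1.integrable_coeFn g')).norm.const_mul _
  have hdist : dist g g' = ∫ x, ‖g x - g' x‖ ∂μ := by
    conv_lhs => rw [← Integrable.toL1_coeFn g (L1.integrable_coeFn g),
      ← Integrable.toL1_coeFn g' (L1.integrable_coeFn g')]
    exact dist_toL1_toL1 _ _
  rw [hdist, ← integral_const_mul, ← integral_add (hint g') hgg]
  refine integral_mono (hint g) ((hint g').add hgg) fun x => ?_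
  have h := hφ.norm_sub_le (g x) (g' x)
  rw [Real.norm_eq_abs] at h
  calc |φ (g x) - b x| = |(φ (g' x) - b x) + (φ (g x) - φ (g' x))| := by ring_nf
    _ ≤ |φ (g' x) - b x| + |φ (g x) - φ (g' x)| := abs_add_le _ _
    _ ≤ |φ (g' x) - b x| + K * ‖g x - g' x‖ := by gcongr

/-- If the indicators of a countable family of sets that separates points are limits of functions of
`g`, then `g` is injective modulo a null set. -/
theorem exists_injOn_of_forall_approx [IsFiniteMeasure μ] {g : X → ℂ}
    {B : ℕ → Set X} (hB : ∀ m, MeasurableSet (B m))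
    (hsep : ∀ x x', (∀ m, x ∈ B m ↔ x' ∈ B m) → x = x') (hgi : Integrable g μ)
    (h : ∀ m j : ℕ, ∃ (φ : ℂ → ℝ) (K : NNReal), LipschitzWith K φ ∧
      ∫ x, |φ (g x) - (B m).indicator 1 x| ∂μ < 1 / (j + 1)) :
    ∃ N : Set X, (∀ᵐ x ∂μ, x ∈ N) ∧ Set.InjOn g N := by
  choose φ K hφ hint using h
  have hlim : ∀ m, ∃ ns : ℕ → ℕ, ∀ᵐ x ∂μ, Filter.Tendsto (fun i => φ m (ns i) (g x)) Filter.atTop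
      (nhds ((B m).indicator 1 x)) := by
    intro m
    have hBi : Integrable ((B m).indicator (1 : X → ℝ)) μ :=
      (integrable_const (1 : ℝ)).indicator (hB m)
    have h0 : Filter.Tendsto (fun j => eLpNorm ((fun x => φ m j (g x)) - (B m).indicator 1) 1 μ)
        Filter.atTop (nhds 0) := by
      have hle : ∀ j : ℕ, eLpNorm ((fun x => φ m j (g x)) - (B m).indicator 1) 1 μ ≤
          ENNReal.ofReal (1 / (j + 1)) := fun j => by
        rw [eLpNorm_one_eq_lintegral_enorm, ← ofReal_integral_norm_eq_lintegral_enorm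
          (((hφ m j).integrable_comp hgi).sub hBi)]
        exact ENNReal.ofReal_le_ofReal (hint m j).le
      refine tendsto_of_tendsto_of_tendsto_of_le_of_le tendsto_const_nhds ?_ (fun _ => zero_le) hle
      simpa using ENNReal.tendsto_ofReal tendsto_one_div_add_atTop_nhds_zero_nat
    obtain ⟨ns, -, hns⟩ := (tendstoInMeasure_of_tendsto_eLpNorm one_ne_zero
      (fun j => ((hφ m j).integrable_comp hgi).aestronglyMeasurable)
      hBi.aestronglyMeasurable h0).exists_seq_tendsto_ae
    exact ⟨ns, hns⟩
  choose ns hns using hlim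
  refine ⟨{x | ∀ m, Filter.Tendsto (fun i => φ m (ns m i) (g x)) Filter.atTop
      (nhds ((B m).indicator 1 x))}, ae_all_iff.2 hns, fun x hx x' hx' hxx => hsep x x' fun m => ?_⟩
  have h1 := hx m
  rw [hxx] at h1
  have h2 := tendsto_nhds_unique h1 (hx' m)
  by_cases hxB : x ∈ B m <;> by_cases hxB' : x' ∈ B m <;> simp_all

/-- The operator `g ↦ ∑ q k • g ∘ T^k` on `L¹`. -/
noncomputable def iterateComb (hT : MeasurePreserving T μ μ) (q : ℕ → ℂ) (d : ℕ) (g : X →₁[μ] ℂ) :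
    X →₁[μ] ℂ :=
  ∑ k ∈ Finset.range (d + 1), q k • Lp.compMeasurePreserving (T^[k]) (hT.iterate k) g

theorem continuous_iterateComb (hT : MeasurePreserving T μ μ) (q : ℕ → ℂ) (d : ℕ) :
    Continuous (iterateComb hT q d) :=
  continuous_finsetSum _ fun k _ =>
    (Lp.isometry_compMeasurePreserving (hT.iterate k)).continuous.const_smul (q k)

theorem coeFn_iterateComb (hT : MeasurePreserving T μ μ) (q : ℕ → ℂ) (d : ℕ) (g : X →₁[μ] ℂ) :
    ∀ᵐ x ∂μ, iterateComb hT q d g x = ∑ k ∈ Finset.range (d + 1), q k * g (T^[k] x) := by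
  have h : ∀ᵐ x ∂μ, ∀ k : ℕ, (q k • Lp.compMeasurePreserving (T^[k]) (hT.iterate k) g : X →₁[μ] ℂ) x
      = q k * g (T^[k] x) := by
    refine ae_all_iff.2 fun k => ?_
    filter_upwards [Lp.coeFn_smul (q k) (Lp.compMeasurePreserving (T^[k]) (hT.iterate k) g),
      Lp.coeFn_compMeasurePreserving g (hT.iterate k)] with x h1 h2
    rw [h1, Pi.smul_apply, h2, smul_eq_mul, Function.comp_apply]
  filter_upwards [h, Lp.coeFn_finsetSum (Finset.range (d + 1)) fun k =>
    (q k • Lp.compMeasurePreserving (T^[k]) (hT.iterate k) g : X →₁[μ] ℂ)] with x hx hs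
  rw [iterateComb, hs, Finset.sum_apply]
  exact Finset.sum_congr rfl fun k _ => hx k

end Lebesgue

section Isomorphism

variable {X : Type v} [MeasurableSpace X] {μ : Measure X} {T : X → X}

/-- By the Lusin–Souslin theorem, a factor map which is injective modulo a null set is an
isomorphism onto its image measure. -/
theorem isomorphicSystems_map_of_injOn [StandardBorelSpace X] [IsProbabilityMeasure μ]
    {Y : Type u} [MeasurableSpace Y] [MeasurableSpace.CountablySeparated Y]
    [MeasurableEq Y] {S : Y → Y} {Φ : X → Y}
    (hΦ : Measurable Φ) {N : Set X} (hN : ∀ᵐ x ∂μ, x ∈ N) (hinj : Set.InjOn Φ N)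
    (hST : ∀ᵐ x ∂μ, Φ (T x) = S (Φ x)) : IsomorphicSystems μ T (μ.map Φ) S := by
  obtain ⟨N', hN'N, hN'm, hN'⟩ : ∃ N' ⊆ N, MeasurableSet N' ∧ ∀ᵐ x ∂μ, x ∈ N' := by
    obtain ⟨t, ht, htm, ht0⟩ := exists_measurable_superset_of_null (μ := μ) (s := Nᶜ) hN
    refine ⟨tᶜ, Set.compl_subset_comm.1 ht, htm.compl, ?_⟩
    rw [ae_iff]
    simpa using ht0
  have : StandardBorelSpace N' := hN'm.standardBorel
  have hemb : MeasurableEmbedding (fun x : N' => Φ x) :=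
    (hΦ.comp measurable_subtype_coe).measurableEmbedding
      fun x x' h => Subtype.ext (hinj (hN'N x.2) (hN'N x'.2) h)
  have : Nonempty X := nonempty_of_isProbabilityMeasure μ
  obtain ⟨Ψ, hΨ, hΨΦ⟩ := hemb.exists_measurable_extend measurable_subtype_coe fun _ => this
  have hleft : ∀ᵐ x ∂μ, Ψ (Φ x) = x := by
    filter_upwards [hN'] with x hx
    exact congrFun hΨΦ ⟨x, hx⟩
  refine ⟨Φ, Ψ, hΦ.measurePreserving μ, ⟨hΨ, ?_⟩, hleft, ?_, hST⟩
  · rw [Measure.map_map hΨ hΦ, Measure.map_congr (f := Ψ ∘ Φ) (g := id) hleft, Measure.map_id]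
  · refine (ae_map_iff hΦ.aemeasurable
      (measurableSet_eq_fun (hΦ.comp hΨ) measurable_id)).2 ?_
    filter_upwards [hleft] with x hx
    change Φ (Ψ (Φ x)) = Φ x
    rw [hx]

end Isomorphism

/-! ### Generic orbit series and the universality criterion -/

section Dual

variable {X : Type v} {T : X → X} {τ : ℤ → X → X}
variable {Z : Type u} [NormedAddCommGroup Z] [NormedSpace ℂ Z] [CompleteSpace Z] {y : ℤ → Z}

theorem dual_orbitSum_eq_sum (hy : Summable y) (hτ : ∀ n : ℕ, τ n = T^[n]) (z₀ : Z →L[ℂ] ℂ)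
    {m d : ℕ} (hz : ∀ n, z₀ (y n) ≠ 0 → ∃ k ≤ d, n = ((m + k : ℕ) : ℤ)) {f : X → ℂ} {C : ℝ}
    (hC : ∀ x, ‖f x‖ ≤ C) (x : X) :
    z₀ (orbitSum τ y f x) =
      ∑ k ∈ Finset.range (d + 1), z₀ (y ((m + k : ℕ) : ℤ)) * f (T^[k] (T^[m] x)) := by
  have hs : Summable fun n => f (τ n x) • y n := hy.smul_of_forall_norm_le fun n => hC (τ n x)
  have hinj : Function.Injective fun k : ℕ => ((m + k : ℕ) : ℤ) := fun a b h => by simpa using h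
  rw [orbitSum, z₀.map_tsum hs, tsum_eq_sum (s := (Finset.range (d + 1)).map ⟨_, hinj⟩),
    Finset.sum_map]
  · refine Finset.sum_congr rfl fun k _ => ?_
    simp only [Function.Embedding.coeFn_mk, map_smul, smul_eq_mul, hτ]
    rw [mul_comm, ← Function.iterate_add_apply, Nat.add_comm k m]
  · intro n hn
    rw [map_smul, smul_eq_mul]
    by_contra hne
    obtain ⟨k, hk, rfl⟩ := hz n (right_ne_zero_of_mul hne)
    exact hn (Finset.mem_map.2 ⟨k, by simpa [Nat.lt_succ_iff] using hk, rfl⟩)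

end Dual

section Model

variable {X : Type v} [MeasurableSpace X] {μ : Measure X} {T : X → X} {τ : ℤ → X → X}
variable {Z : Type u} [NormedAddCommGroup Z] [NormedSpace ℂ Z] [CompleteSpace Z] {y : ℤ → Z}

theorem integrable_orbitSum_simpleFunc [IsFiniteMeasure μ] (hy : Summable y)
    (hτ : ∀ n, Measurable (τ n)) (f : SimpleFunc X ℂ) : Integrable (orbitSum τ y f) μ :=
  integrable_orbitSum hy hτ f.measurable f.exists_forall_norm_le.choose_spec

/-- A simple function together with its orbit series, as a point of `L¹ × L¹`. -/
noncomputable def orbitPair [IsFiniteMeasure μ] (hy : Summable y) (hτ : ∀ n, Measurable (τ n))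
    (f : SimpleFunc X ℂ) : (X →₁[μ] ℂ) × (X →₁[μ] Z) :=
  (f.integrable_of_isFiniteMeasure.toL1 f,
    (integrable_orbitSum_simpleFunc hy hτ f).toL1 (orbitSum τ y f))

theorem coeFn_orbitPair [IsFiniteMeasure μ] (hy : Summable y) (hτ : ∀ n, Measurable (τ n))
    (f : SimpleFunc X ℂ) : ∀ᵐ x ∂μ, (orbitPair (μ := μ) hy hτ f).1 x = f x ∧
      (orbitPair (μ := μ) hy hτ f).2 x = orbitSum τ y f x :=
  (f.integrable_of_isFiniteMeasure.coeFn_toL1).and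
    (integrable_orbitSum_simpleFunc hy hτ f).coeFn_toL1

theorem dist_orbitPair_lt [IsFiniteMeasure μ] (hy : Summable y) (hτ : ∀ n, Measurable (τ n))
    {f g : SimpleFunc X ℂ} {η : ℝ} (h1 : ∫ x, ‖f x - g x‖ ∂μ < η)
    (h2 : ∫ x, ‖orbitSum τ y f x - orbitSum τ y g x‖ ∂μ < η) :
    dist (orbitPair (μ := μ) hy hτ f) (orbitPair hy hτ g) < η := by
  rw [Prod.dist_eq, max_lt_iff]
  exact ⟨(dist_toL1_toL1 f.integrable_of_isFiniteMeasure
    g.integrable_of_isFiniteMeasure).trans_lt h1, (dist_toL1_toL1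
    (integrable_orbitSum_simpleFunc hy hτ f) (integrable_orbitSum_simpleFunc hy hτ g)).trans_lt h2⟩

/-- A functional that is `1` at `y 0` recovers `f` from its one-sided orbit series, up to a function
of `T x`. -/
theorem exists_dual_orbitSum_eq_add_comp [IsFiniteMeasure μ] (hy : Summable y)
    (hτ : IsOrbitFamily μ T τ (Function.support y)) (hneg : ∀ n < 0, y n = 0)
    (w : Z →L[ℂ] ℂ) (hw : w (y 0) = 1) (f : SimpleFunc X ℂ) :
    ∃ u : X → ℂ, Integrable u μ ∧ ∀ x, w (orbitSum τ y f x) = f x + u (T x) := by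
  obtain ⟨C, hC⟩ := f.exists_forall_norm_le
  let y' : ℤ → ℂ := {n | 0 ≤ n}.indicator fun n => w (y (n + 1))
  have hy' : Summable y' :=
    (((Equiv.addRight (1 : ℤ)).summable_iff.2 hy).mapL w).indicator _
  refine ⟨orbitSum τ y' f, integrable_orbitSum hy' (fun n => (hτ.measurePreserving n).measurable)
    f.measurable hC, fun x => ?_⟩
  have hs : Summable fun n => f (τ n x) • y n := hy.smul_of_forall_norm_le fun n => hC (τ n x)
  have hs' : Summable fun n => f (τ n x) * w (y n) := by simpa using hs.mapL w
  rw [orbitSum, w.map_tsum hs]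
  simp only [map_smul, smul_eq_mul]
  rw [hs'.tsum_eq_add_tsum_ite 0, hw, mul_one, orbitSum, ← (Equiv.addRight (1 : ℤ)).tsum_eq]
  have h0 : τ 0 x = x := by simpa using congrFun (hτ.natCast 0) x
  rw [h0]
  congr 1
  refine tsum_congr fun n => ?_
  rcases lt_trichotomy n (-1) with hn | rfl | hn
  · simp [y', hneg (n + 1) (by lia), show ¬ 0 ≤ n by lia]
  · simp [y']
  · obtain ⟨k, rfl⟩ := Int.eq_ofNat_of_zero_le (show 0 ≤ n by lia)
    have hk : τ ((k : ℤ) + 1) x = T^[k] (T x) := by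
      have := congrFun (hτ.natCast (k + 1)) x
      rwa [Nat.cast_add, Nat.cast_one] at this
    simp [y', show (k : ℤ) + 1 ≠ 0 by lia, hk, hτ.natCast]

/-- The Baire category argument: a generic element of the closure of the set of all pairs `(f, Φ)`,
where `Φ` is the orbit series of the simple function `f`, charges all open sets and generates. -/
theorem exists_generic_pair [StandardBorelSpace X] [IsProbabilityMeasure μ] [NullSingletonClass μ]
    [SecondCountableTopology Z] (hT : Ergodic T μ) (hy : Summable y)
    (hτ : IsOrbitFamily μ T τ (Function.support y)) (hJ : ∀ n, y n ≠ 0 → y (n + 1) ≠ 0)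
    (hspan : (Submodule.span ℂ (Set.range y)).topologicalClosure = ⊤)
    {q : ℕ → ℂ} (hq : q 0 ≠ 0) (d : ℕ) :
    ∃ p ∈ closure (Set.range (orbitPair (μ := μ) hy fun n => (hτ.measurePreserving n).measurable)),
      (∀ U : Set Z, IsOpen U → U.Nonempty → μ {x | p.2 x ∈ U} ≠ 0) ∧
      (∃ N : Set X, (∀ᵐ x ∂μ, x ∈ N) ∧ Set.InjOn p.1 N) ∧
      ∃ N : Set X, (∀ᵐ x ∂μ, x ∈ N) ∧
        Set.InjOn (fun x => ∑ k ∈ Finset.range (d + 1), q k * p.1 (T^[k] x)) N := by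
  have hτm : ∀ n, Measurable (τ n) := fun n => (hτ.measurePreserving n).measurable
  have hTm := hT.toMeasurePreserving
  obtain ⟨B, hB, hBsep⟩ := exists_seq_separating X MeasurableSet.empty Set.univ
  -- The combination for `false` is `f` itself.
  let qs : Bool → ℕ → ℂ := fun b => bif b then q else 1
  let ds : Bool → ℕ := fun b => bif b then d else 0
  have hqs : ∀ b, qs b 0 ≠ 0 := fun b => by cases b <;> simp [qs, hq]
  let O : (TopologicalSpace.countableBasis Z) ⊕ (Bool × ℕ × ℕ) →
      Set ((X →₁[μ] ℂ) × (X →₁[μ] Z)) := Sum.elim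
    (fun U => Prod.snd ⁻¹' {Φ | μ {x | Φ x ∈ (U : Set Z)} ≠ 0})
    (fun i => ⋃ (φ : ℂ → ℝ) (K : NNReal) (_ : LipschitzWith K φ),
      (fun p => iterateComb hTm (qs i.1) (ds i.1) p.1) ⁻¹'
        {g | ∫ x, |φ (g x) - (B i.2.1).indicator 1 x| ∂μ < 1 / (i.2.2 + 1)})
  have hO : ∀ i, IsOpen (O i) := by
    rintro (U | ⟨b, m, j⟩)
    · exact (isOpen_setOf_measure_mem_ne_zero
        (TopologicalSpace.isOpen_of_mem_countableBasis U.2)).preimage continuous_snd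
    · refine isOpen_iUnion fun φ => isOpen_iUnion fun K => isOpen_iUnion fun hφ => ?_
      exact (isOpen_lt (continuous_integral_abs_comp_sub hφ
        ((integrable_const (1 : ℝ)).indicator (hB m))) continuous_const).preimage
        ((continuous_iterateComb _ _ _).comp continuous_fst)
  obtain ⟨p, hp, hpO⟩ := exists_mem_closure_forall_mem
    (V := Set.range (orbitPair (μ := μ) hy hτm)) ⟨_, ⟨0, rfl⟩⟩ hO (by
      rintro (U | ⟨b, m, j⟩) _ ⟨f, rfl⟩ η hη
      · have hUo := TopologicalSpace.isOpen_of_mem_countableBasis U.2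
        have hdense : Dense (Submodule.span ℂ (Set.range y) : Set Z) :=
          Submodule.dense_iff_topologicalClosure_eq_top.2 hspan
        obtain ⟨z, hz, hzU⟩ := hdense.exists_mem_open hUo
          (TopologicalSpace.nonempty_of_mem_countableBasis U.2)
        obtain ⟨f', h1, h2, h3⟩ :=
          exists_simpleFunc_orbitSum_mem_open hT hy hτ hJ f hη hUo hzU hz
        refine ⟨_, ⟨f', rfl⟩, dist_orbitPair_lt hy hτm h1 h2, ?_⟩
        refine fun h0 => h3 (measure_mono_null_ae ?_ h0)
        filter_upwards [coeFn_orbitPair hy hτm f'] with x hx hxU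
        change (orbitPair hy hτm f').2 x ∈ _
        rw [hx.2]
        exact hxU
      · obtain ⟨f', h1, h2, φ, K, hφ, h3⟩ := exists_simpleFunc_separating (τ := τ) hT
          (fun δ hδ => by
            obtain ⟨D, hD, hD0, hDδ, -⟩ := hT.exists_small_disjoint_preimages 0 hδ
            exact ⟨D, hD, hD0, hDδ⟩) hy f hη (hB m) (hqs b) (ds b)
          (ε := 1 / (j + 1)) (by positivity)
        refine ⟨_, ⟨f', rfl⟩, dist_orbitPair_lt hy hτm h1 h2, ?_⟩
        refine Set.mem_iUnion.2 ⟨φ, Set.mem_iUnion.2 ⟨K, Set.mem_iUnion.2 ⟨hφ, ?_⟩⟩⟩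
        refine lt_of_eq_of_lt (integral_congr_ae ?_) h3
        filter_upwards [coeFn_iterateComb hTm (qs b) (ds b) (orbitPair hy hτm f').1,
          ae_all_iff.2 fun k : ℕ => (hTm.iterate k).quasiMeasurePreserving.ae
            (coeFn_orbitPair hy hτm f')] with x hx hfx
        simp only [hx, hfx])
  have hsep : ∀ x x', (∀ m, x ∈ B m ↔ x' ∈ B m) → x = x' := fun x x' h =>
    hBsep x (Set.mem_univ _) x' (Set.mem_univ _) h
  have hinj : ∀ b, ∃ N : Set X, (∀ᵐ x ∂μ, x ∈ N) ∧
      Set.InjOn (fun x => ∑ k ∈ Finset.range (ds b + 1), qs b k * p.1 (T^[k] x)) N := by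
    intro b
    obtain ⟨N, hN, hNinj⟩ := exists_injOn_of_forall_approx hB hsep
      (L1.integrable_coeFn (iterateComb hTm (qs b) (ds b) p.1)) fun m j => by
        obtain ⟨φ, hφ⟩ := Set.mem_iUnion.1 (hpO (Sum.inr (b, m, j)))
        obtain ⟨K, hK⟩ := Set.mem_iUnion.1 hφ
        obtain ⟨hL, h⟩ := Set.mem_iUnion.1 hK
        exact ⟨φ, K, hL, h⟩
    refine ⟨N ∩ {x | iterateComb hTm (qs b) (ds b) p.1 x =
      ∑ k ∈ Finset.range (ds b + 1), qs b k * p.1 (T^[k] x)},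
      hN.and (coeFn_iterateComb hTm (qs b) (ds b) p.1), fun x hx x' hx' h => hNinj hx.1 hx'.1 ?_⟩
    rw [hx.2, hx'.2]
    exact h
  refine ⟨p, hp, fun U hU hne h0 => ?_, by simpa [qs, ds] using hinj false, hinj true⟩
  obtain ⟨z, hz⟩ := hne
  obtain ⟨W, hW, -, hWU⟩ := (TopologicalSpace.isBasis_countableBasis Z).exists_subset_of_mem_open
    hz hU
  exact hpO (Sum.inl ⟨W, hW⟩) (measure_mono_null (fun x hx => hWU hx) h0)

/-- Universality criterion. If `A` shifts the terms of an unconditionally convergent series with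
dense span, and some functional vanishes at all but finitely many of them, then every ergodic
system with orbit maps `τ` is modelled by `A`. The functional only determines `T^[m] x`; when `m ≠ 0`
the remaining information about `x` is recovered one step at a time from `y 0`. -/
theorem isModelledBy_of_isOrbitFamily [MeasurableSpace Z] [BorelSpace Z] [StandardBorelSpace X]
    [IsProbabilityMeasure μ] [NullSingletonClass μ] {A : Z →L[ℂ] Z} (hT : Ergodic T μ)
    (hy : Summable y) (hA : ∀ n, A (y (n + 1)) = y n)
    (hτ : IsOrbitFamily μ T τ (Function.support y))
    (hspan : (Submodule.span ℂ (Set.range y)).topologicalClosure = ⊤)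
    (z₀ : Z →L[ℂ] ℂ) {m d : ℕ} (hm : z₀ (y m) ≠ 0)
    (hz : ∀ n, z₀ (y n) ≠ 0 → ∃ k ≤ d, n = ((m + k : ℕ) : ℤ))
    (hneg : m = 0 ∨ y 0 ≠ 0 ∧ ∀ n < 0, y n = 0) : IsModelledBy A μ T := by
  have hτm : ∀ n, Measurable (τ n) := fun n => (hτ.measurePreserving n).measurable
  have hTm := hT.toMeasurePreserving
  have hJ : ∀ n, y n ≠ 0 → y (n + 1) ≠ 0 := fun n hn h0 => hn (by rw [← hA, h0, map_zero])
  have : SecondCountableTopology Z := by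
    have hs : TopologicalSpace.IsSeparable (Set.univ : Set Z) := by
      have := ((Set.countable_range y).isSeparable.span (R := ℂ)).closure
      rwa [← Submodule.topologicalClosure_coe, hspan] at this
    have : TopologicalSpace.SeparableSpace Z := TopologicalSpace.isSeparable_univ_iff.1 hs
    exact UniformSpace.secondCountable_of_separable Z
  obtain ⟨⟨f, Φ₁⟩, hp, hfull, ⟨N₁, hN₁, hinj₁⟩, N₂, hN₂, hinj₂⟩ := exists_generic_pair hT hy hτ hJ
    hspan (q := fun k => z₀ (y ((m + k : ℕ) : ℤ))) (by simpa using hm) d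
  -- Relations that hold for orbit series of simple functions and are closed in `L¹ × L¹`.
  have hcoe := coeFn_orbitPair (μ := μ) hy hτm
  have hequiv : ∀ᵐ x ∂μ, Φ₁ (T x) = A (Φ₁ x) := by
    have hcl : IsClosed {p : (X →₁[μ] ℂ) × (X →₁[μ] Z) |
        Lp.compMeasurePreserving T hTm p.2 = A.compLp p.2} :=
      isClosed_eq ((Lp.isometry_compMeasurePreserving hTm).continuous.comp continuous_snd)
        ((A.compLpL 1 μ).continuous.comp continuous_snd)
    have h : Lp.compMeasurePreserving T hTm Φ₁ = A.compLp Φ₁ := by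
      refine closure_minimal ?_ hcl hp
      rintro _ ⟨g, rfl⟩
      obtain ⟨C, hC⟩ := g.exists_forall_norm_le
      refine Lp.ext ?_
      filter_upwards [Lp.coeFn_compMeasurePreserving (orbitPair (μ := μ) hy hτm g).2 hTm,
        A.coeFn_compLp (orbitPair (μ := μ) hy hτm g).2, hcoe g,
        hTm.quasiMeasurePreserving.ae (hcoe g), ae_orbitSum_map hy hA hτ hC] with x h1 h2 h3 h4 h5
      rw [h1, h2, Function.comp_apply, h3.2, h4.2, h5]
    filter_upwards [Lp.coeFn_compMeasurePreserving Φ₁ hTm, A.coeFn_compLp Φ₁] with x h1 h2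
    rw [← h2, ← h, h1, Function.comp_apply]
  have hz₀ : ∀ᵐ x ∂μ, z₀ (Φ₁ x) = ∑ k ∈ Finset.range (d + 1),
      z₀ (y ((m + k : ℕ) : ℤ)) * f (T^[k] (T^[m] x)) := by
    have hcl : IsClosed {p : (X →₁[μ] ℂ) × (X →₁[μ] Z) | z₀.compLp p.2 =
        Lp.compMeasurePreserving (T^[m]) (hTm.iterate m)
          (iterateComb hTm (fun k => z₀ (y ((m + k : ℕ) : ℤ))) d p.1)} :=
      isClosed_eq ((z₀.compLpL 1 μ).continuous.comp continuous_snd)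
        ((Lp.isometry_compMeasurePreserving (hTm.iterate m)).continuous.comp
          ((continuous_iterateComb _ _ _).comp continuous_fst))
    have hcomb : ∀ g : X →₁[μ] ℂ, ∀ᵐ x ∂μ, Lp.compMeasurePreserving (T^[m]) (hTm.iterate m)
        (iterateComb hTm (fun k => z₀ (y ((m + k : ℕ) : ℤ))) d g) x =
        ∑ k ∈ Finset.range (d + 1), z₀ (y ((m + k : ℕ) : ℤ)) * g (T^[k] (T^[m] x)) := by
      intro g
      filter_upwards [Lp.coeFn_compMeasurePreserving (iterateComb hTm
        (fun k => z₀ (y ((m + k : ℕ) : ℤ))) d g) (hTm.iterate m),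
        (hTm.iterate m).quasiMeasurePreserving.ae (coeFn_iterateComb hTm _ d g)] with x h1 h2
      rw [h1, Function.comp_apply, h2]
    have h : z₀.compLp Φ₁ = Lp.compMeasurePreserving (T^[m]) (hTm.iterate m)
        (iterateComb hTm (fun k => z₀ (y ((m + k : ℕ) : ℤ))) d f) := by
      refine closure_minimal ?_ hcl hp
      rintro _ ⟨g, rfl⟩
      obtain ⟨C, hC⟩ := g.exists_forall_norm_le
      refine Lp.ext ?_
      filter_upwards [hcomb (orbitPair (μ := μ) hy hτm g).1,
        z₀.coeFn_compLp (orbitPair (μ := μ) hy hτm g).2, hcoe g,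
        ae_all_iff.2 fun k : ℕ => ((hTm.iterate k).comp
          (hTm.iterate m)).quasiMeasurePreserving.ae (hcoe g)] with x h1 h2 h3 h4
      rw [h1, h2, h3.2, dual_orbitSum_eq_sum hy hτ.natCast z₀ hz hC]
      exact Finset.sum_congr rfl fun k _ => congrArg (_ * ·) (h4 k).1.symm
    filter_upwards [hcomb f, z₀.coeFn_compLp Φ₁] with x h1 h2
    rw [← h2, h, h1]
  have hw : m ≠ 0 → ∃ (w : Z →L[ℂ] ℂ) (u : X → ℂ), ∀ᵐ x ∂μ, w (Φ₁ x) = f x + u (T x) := by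
    intro hm0
    obtain ⟨hy0, hyneg⟩ := hneg.resolve_left hm0
    obtain ⟨w, hw⟩ := SeparatingDual.exists_eq_one (R := ℂ) hy0
    -- The functions of `T x` form a closed subspace of `L¹`, the range of an isometry.
    have hcl : IsClosed {p : (X →₁[μ] ℂ) × (X →₁[μ] Z) | w.compLp p.2 - p.1 ∈
        Set.range (Lp.compMeasurePreserving (E := ℂ) (p := 1) T hTm)} :=
      (Lp.isometry_compMeasurePreserving hTm).isClosedEmbedding.isClosed_range.preimage
        (((w.compLpL 1 μ).continuous.comp continuous_snd).sub continuous_fst)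
    obtain ⟨u, hu⟩ : w.compLp Φ₁ - f ∈
        Set.range (Lp.compMeasurePreserving (E := ℂ) (p := 1) T hTm) := by
      refine closure_minimal ?_ hcl hp
      rintro _ ⟨g, rfl⟩
      obtain ⟨u, hu, hux⟩ := exists_dual_orbitSum_eq_add_comp hy hτ hyneg w hw g
      refine ⟨hu.toL1 u, Lp.ext ?_⟩
      filter_upwards [Lp.coeFn_compMeasurePreserving (hu.toL1 u) hTm,
        hTm.quasiMeasurePreserving.ae hu.coeFn_toL1, hcoe g,
        Lp.coeFn_sub (w.compLp (orbitPair (μ := μ) hy hτm g).2) (orbitPair (μ := μ) hy hτm g).1,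
        w.coeFn_compLp (orbitPair (μ := μ) hy hτm g).2] with x h1 h2 h3 h4 h5
      rw [h1, Function.comp_apply, h2, h4, Pi.sub_apply, h5, h3.1, h3.2, hux, add_sub_cancel_left]
    refine ⟨w, u, ?_⟩
    filter_upwards [Lp.coeFn_compMeasurePreserving u hTm, w.coeFn_compLp Φ₁,
      Lp.coeFn_sub (w.compLp Φ₁) f] with x h1 h2 h3
    rw [← hu, h1, Function.comp_apply, Pi.sub_apply, h2] at h3
    rw [h3, add_sub_cancel]
  let Φ : X → Z := Φ₁
  have hΦ : Measurable Φ := (Lp.stronglyMeasurable Φ₁).measurable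
  have hiter : ∀ᵐ x ∂μ, ∀ k : ℕ, Φ (T^[k] x) = (A^[k]) (Φ x) := by
    filter_upwards [ae_all_iff.2 fun k : ℕ =>
      (hTm.iterate k).quasiMeasurePreserving.ae hequiv] with x hx k
    induction k with
    | zero => rfl
    | succ k ih =>
      rw [Function.iterate_succ_apply', Function.iterate_succ_apply', ← ih]
      exact hx k
  have hinj : ∃ N : Set X, (∀ᵐ x ∂μ, x ∈ N) ∧ Set.InjOn Φ N := by
    have hTmN : ∀ᵐ x ∂μ, T^[m] x ∈ N₂ := (hTm.iterate m).quasiMeasurePreserving.ae hN₂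
    have hTm_eq : ∀ {x x'}, z₀ (Φ x) = ∑ k ∈ Finset.range (d + 1),
        z₀ (y ((m + k : ℕ) : ℤ)) * f (T^[k] (T^[m] x)) →
        z₀ (Φ x') = ∑ k ∈ Finset.range (d + 1),
        z₀ (y ((m + k : ℕ) : ℤ)) * f (T^[k] (T^[m] x')) → T^[m] x ∈ N₂ → T^[m] x' ∈ N₂ →
        Φ x = Φ x' → T^[m] x = T^[m] x' := fun h h' hx hx' hΦx =>
      hinj₂ hx hx' (by simpa only [← h, ← h'] using congrArg z₀ hΦx)
    rcases eq_or_ne m 0 with rfl | hm0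
    · refine ⟨_, hz₀.and hTmN, fun x hx x' hx' h => ?_⟩
      exact hTm_eq hx.1 hx'.1 hx.2 hx'.2 h
    · obtain ⟨w, u, hwu⟩ := hw hm0
      refine ⟨_, (hz₀.and hTmN).and (hiter.and (ae_all_iff.2 fun k : ℕ =>
        (hTm.iterate k).quasiMeasurePreserving.ae (hwu.and hN₁))), ?_⟩
      rintro x ⟨⟨h1, h2⟩, h3, h4⟩ x' ⟨⟨h1', h2'⟩, h3', h4'⟩ h
      have hdesc : ∀ j ≤ m, T^[m - j] x = T^[m - j] x' := by
        intro j
        induction j with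
        | zero => exact fun _ => hTm_eq h1 h1' h2 h2' h
        | succ j ih =>
          intro hj
          have hstep := ih (by lia)
          rw [show m - j = (m - (j + 1)) + 1 by lia, Function.iterate_succ_apply',
            Function.iterate_succ_apply'] at hstep
          have hΦk : Φ (T^[m - (j + 1)] x) = Φ (T^[m - (j + 1)] x') := by rw [h3, h3', h]
          have hfk := (h4 (m - (j + 1))).1
          have hfk' := (h4' (m - (j + 1))).1
          refine hinj₁ (h4 _).2 (h4' _).2 ?_
          change w (Φ _) = _ at hfk hfk'
          rw [hΦk, hfk', hstep] at hfk
          exact (add_right_cancel hfk).symm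
      simpa using hdesc m le_rfl
  obtain ⟨N, hN, hinjN⟩ := hinj
  refine ⟨μ.map Φ, Measure.isProbabilityMeasure_map hΦ.aemeasurable, ⟨fun U hU hne => ?_⟩,
    ⟨A.measurable, ?_⟩, isomorphicSystems_map_of_injOn hΦ hN hinjN hequiv⟩
  · rw [Measure.map_apply hΦ hU.measurableSet]
    exact hfull U hU hne
  · rw [Measure.map_map A.measurable hΦ, Measure.map_congr (f := A ∘ Φ) (g := Φ ∘ T)
      (by filter_upwards [hequiv] with x hx using hx.symm), ← Measure.map_map hΦ hT.measurable,
      hTm.map_eq]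

end Model

/-! ### Fourier coefficients of eigenvectorfields -/

section Fourier

open AddCircle

variable {Z : Type u} [NormedAddCommGroup Z] [NormedSpace ℂ Z]

theorem measurable_toCircle_one : Measurable (AddCircle.toCircle (T := (1 : ℝ))) :=
  continuous_toCircle.measurable

instance : IsProbabilityMeasure circleMeasure :=
  Measure.isProbabilityMeasure_map measurable_toCircle_one.aemeasurable

theorem measurePreserving_toCircle_one : MeasurePreserving (AddCircle.toCircle (T := (1 : ℝ)))
    (haarAddCircle (T := (1 : ℝ))) circleMeasure :=
  measurable_toCircle_one.measurePreserving _

theorem coe_toCircle_zpow (n : ℤ) (x : AddCircle (1 : ℝ)) :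
    ((toCircle x : Circle) : ℂ) ^ n = fourier n x := by
  rw [fourier_apply, toCircle_zsmul, Circle.coe_zpow]

theorem continuous_coe_circle_zpow (n : ℤ) : Continuous fun l : Circle => (l : ℂ) ^ n :=
  Continuous.zpow₀ (by fun_prop) n fun l => Or.inl l.coe_ne_zero

theorem circleFourierCoeff_eq_fourierCoeff {g : Circle → Z}
    (hg : AEStronglyMeasurable g circleMeasure) (n : ℤ) :
    circleFourierCoeff g n = fourierCoeff (g ∘ toCircle (T := (1 : ℝ))) n := by
  refine (integral_map measurable_toCircle_one.aemeasurable
    ((continuous_coe_circle_zpow (-n)).aestronglyMeasurable.smul hg)).trans ?_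
  exact integral_congr_ae (Filter.Eventually.of_forall fun x => by
    simp only [Pi.smul_apply', coe_toCircle_zpow, Function.comp_apply])

theorem integrable_zpow_smul {E : Circle → Z} (hE : MemLp E 2 circleMeasure) (n : ℤ) :
    Integrable (fun l : Circle => (l : ℂ) ^ n • E l) circleMeasure := by
  refine (hE.integrable one_le_two).bdd_smul 1
    (continuous_coe_circle_zpow n).aestronglyMeasurable (Filter.Eventually.of_forall fun l => ?_)
  rw [norm_zpow, Circle.norm_coe, one_zpow]

theorem map_circleFourierCoeff [CompleteSpace Z] {W : Type*} [NormedAddCommGroup W]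
    [NormedSpace ℂ W] [CompleteSpace W] {E : Circle → Z} (hE : MemLp E 2 circleMeasure)
    (L : Z →L[ℂ] W) (n : ℤ) :
    L (circleFourierCoeff E n) = circleFourierCoeff (fun l => L (E l)) n := by
  rw [circleFourierCoeff, ← L.integral_comp_comm (integrable_zpow_smul hE _)]
  simp only [map_smul, circleFourierCoeff]

theorem IsL2Eigenvectorfield.map_circleFourierCoeff [CompleteSpace Z] {A : Z →L[ℂ] Z}
    {E : Circle → Z} (hE : IsL2Eigenvectorfield A E) (n : ℤ) :
    A (circleFourierCoeff E (n + 1)) = circleFourierCoeff E n := by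
  rw [_root_.map_circleFourierCoeff hE.1, circleFourierCoeff, circleFourierCoeff]
  refine integral_congr_ae ?_
  filter_upwards [hE.2] with l hl
  rw [hl, smul_smul, ← zpow_add_one₀ (Circle.coe_ne_zero l)]
  congr 2
  ring

theorem ae_eq_zero_of_circleFourierCoeff_eq_zero {g : Circle → ℂ} (hg : MemLp g 2 circleMeasure)
    (h : ∀ n, circleFourierCoeff g n = 0) : ∀ᵐ l ∂circleMeasure, g l = 0 := by
  have hg' : MemLp (g ∘ toCircle (T := (1 : ℝ))) 2 (haarAddCircle (T := (1 : ℝ))) :=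
    hg.comp_measurePreserving measurePreserving_toCircle_one
  have hsum := hasSum_fourier_series_L2 (hg'.toLp _)
  have h0 : hg'.toLp (g ∘ toCircle (T := (1 : ℝ))) = 0 := by
    refine hsum.unique ?_
    convert hasSum_zero (α := Lp ℂ 2 (haarAddCircle (T := (1 : ℝ)))) using 2 with n
    rw [fourierCoeff_congr_ae hg'.coeFn_toLp, ← circleFourierCoeff_eq_fourierCoeff hg.1, h,
      zero_smul]
  have h1 : g ∘ toCircle (T := (1 : ℝ)) =ᵐ[haarAddCircle] 0 := by
    have := hg'.coeFn_toLp
    rw [h0] at this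
    exact this.symm.trans (Lp.coeFn_zero _ _ _)
  have h2 : ∀ᵐ l ∂circleMeasure, hg.1.mk g l = 0 := by
    refine (ae_map_iff measurable_toCircle_one.aemeasurable
      (hg.1.stronglyMeasurable_mk.measurable (measurableSet_singleton 0))).2 ?_
    filter_upwards [h1, measurePreserving_toCircle_one.quasiMeasurePreserving.ae hg.1.ae_eq_mk]
      with x hx hx'
    rw [← hx']
    exact hx
  filter_upwards [h2, hg.1.ae_eq_mk] with l hl hl'
  rw [hl', hl]

theorem circleFourierCoeff_trigPolyEval (c : ℤ →₀ ℂ) (n : ℤ) :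
    circleFourierCoeff (trigPolyEval c) n = c n := by
  have hcont : Continuous (trigPolyEval c) :=
    continuous_finsetSum _ fun k _ => (continuous_coe_circle_zpow k).const_mul (c k)
  have hcomp : trigPolyEval c ∘ toCircle (T := (1 : ℝ)) =
      ∑ k ∈ c.support, fun x => c k * (fourier k x : ℂ) := by
    ext x
    simp only [Function.comp_apply, trigPolyEval, Finsupp.sum, Finset.sum_apply, coe_toCircle_zpow]
  rw [circleFourierCoeff_eq_fourierCoeff hcont.aestronglyMeasurable, hcomp,
    fourierCoeff.sum _ _ fun k _ => ((fourier k).continuous.const_mul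
      (c k)).integrable_of_hasCompactSupport (HasCompactSupport.of_compactSpace _),
    Finset.sum_apply]
  simp only [fourierCoeff.const_mul, fourierCoeff_fourier, Pi.single_apply]
  simp +contextual

theorem eq_zero_of_ae_apply_eq_zero {E : Circle → Z}
    (h_span : ∀ B : Set Circle, MeasurableSet B → circleMeasure B = 1 →
      (Submodule.span ℂ (E '' B)).topologicalClosure = ⊤)
    (w : Z →L[ℂ] ℂ) (hw : ∀ᵐ l ∂circleMeasure, w (E l) = 0) : w = 0 := by
  obtain ⟨t, ht, htm, ht0⟩ := exists_measurable_superset_of_null hw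
  have hspan := h_span tᶜ htm.compl (prob_compl_eq_one_iff htm |>.2 ht0)
  have hle : Submodule.span ℂ (E '' tᶜ) ≤ w.ker := by
    rw [Submodule.span_le]
    rintro _ ⟨l, hl, rfl⟩
    by_contra h
    exact hl (ht h)
  have hle' := Submodule.topologicalClosure_minimal _ hle w.isClosed_ker
  rw [hspan] at hle'
  ext z
  exact hle' (Submodule.mem_top (x := z))

theorem Submodule.topologicalClosure_eq_top_of_forall_dual (p : Submodule ℂ Z)
    (h : ∀ w : Z →L[ℂ] ℂ, (∀ z ∈ p, w z = 0) → w = 0) : p.topologicalClosure = ⊤ := by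
  refine eq_top_iff.2 fun z _ => ?_
  by_contra hz
  obtain ⟨w, a, hwz, hw⟩ := RCLike.geometric_hahn_banach_point_closed (𝕜 := ℂ)
    (p.topologicalClosure.restrictScalars ℝ).convex p.isClosed_topologicalClosure hz
  have ha : a < 0 := by simpa using hw 0 (zero_mem _)
  have hw0 : w = 0 := by
    refine h w fun b hb => ?_
    by_contra hne
    have := hw ((a / w b : ℂ) • b)
      (p.topologicalClosure.smul_mem _ (p.le_topologicalClosure hb))
    rw [map_smul, smul_eq_mul, div_mul_cancel₀ _ hne] at this
    simp at this
  rw [hw0] at hwz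
  simp at hwz
  linarith

theorem span_circleFourierCoeff_dense [CompleteSpace Z] {E : Circle → Z}
    (hE : MemLp E 2 circleMeasure)
    (h_span : ∀ B : Set Circle, MeasurableSet B → circleMeasure B = 1 →
      (Submodule.span ℂ (E '' B)).topologicalClosure = ⊤) :
    (Submodule.span ℂ (Set.range (circleFourierCoeff E))).topologicalClosure = ⊤ := by
  refine Submodule.topologicalClosure_eq_top_of_forall_dual _ fun w hw => ?_
  refine eq_zero_of_ae_apply_eq_zero h_span w ?_
  refine ae_eq_zero_of_circleFourierCoeff_eq_zero (w.comp_memLp' hE) fun n => ?_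
  exact (map_circleFourierCoeff hE w n).symm.trans (hw _ (Submodule.subset_span ⟨n, rfl⟩))

end Fourier

section OrbitMaps

variable {X : Type v}

/-- The two-sided iterates of `T`, with `S` in the role of the inverse. -/
def twoSidedIterate (T S : X → X) : ℤ → X → X
  | Int.ofNat n => T^[n]
  | Int.negSucc n => S^[n + 1]

variable [MeasurableSpace X] {μ : Measure X} {T S : X → X}

theorem measurePreserving_twoSidedIterate (hT : MeasurePreserving T μ μ)
    (hS : MeasurePreserving S μ μ) : ∀ n, MeasurePreserving (twoSidedIterate T S n) μ μ
  | Int.ofNat n => hT.iterate n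
  | Int.negSucc n => hS.iterate (n + 1)

theorem isOrbitFamily_of_nonneg (hT : MeasurePreserving T μ μ) {J : Set ℤ}
    (hJ : ∀ n ∈ J, 0 ≤ n) : IsOrbitFamily μ T (twoSidedIterate T id) J where
  measurePreserving := measurePreserving_twoSidedIterate hT (MeasurePreserving.id μ)
  natCast _ := rfl
  map_apply n hn := by
    obtain ⟨k, rfl⟩ := Int.eq_ofNat_of_zero_le (hJ n hn)
    exact Filter.Eventually.of_forall fun x => (Function.iterate_succ_apply' T k x).symm
  apply_map n hn := by
    obtain ⟨k, rfl⟩ := Int.eq_ofNat_of_zero_le (hJ n hn)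
    exact Filter.Eventually.of_forall fun x => (Function.iterate_succ_apply T k x).symm

theorem isOrbitFamily_of_inverse (hT : MeasurePreserving T μ μ) (hS : MeasurePreserving S μ μ)
    (hST : ∀ᵐ x ∂μ, S (T x) = x) (hTS : ∀ᵐ x ∂μ, T (S x) = x) (J : Set ℤ) :
    IsOrbitFamily μ T (twoSidedIterate T S) J where
  measurePreserving := measurePreserving_twoSidedIterate hT hS
  natCast _ := rfl
  map_apply n _ := by
    rcases n with k | k
    · exact Filter.Eventually.of_forall fun x => (Function.iterate_succ_apply' T k x).symm
    · filter_upwards [(hS.iterate k).quasiMeasurePreserving.ae hTS] with x hx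
      change T (S^[k + 1] x) = _
      rw [Function.iterate_succ_apply', hx]
      cases k <;> rfl
  apply_map n _ := by
    rcases n with k | k
    · exact Filter.Eventually.of_forall fun x => (Function.iterate_succ_apply T k x).symm
    · filter_upwards [hST] with x hx
      change S^[k + 1] (T x) = _
      rw [Function.iterate_succ_apply, hx]
      cases k <;> rfl

end OrbitMaps

/-- The universality criterion for the Fourier coefficients of an eigenvectorfield, with the
indices shifted so that `n₀` becomes `0`. -/
theorem isModelledBy_of_circleFourierCoeff {Z : Type u} [NormedAddCommGroup Z] [NormedSpace ℂ Z]
    [CompleteSpace Z] [MeasurableSpace Z] [BorelSpace Z] {A : Z →L[ℂ] Z} {E : Circle → Z}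
    (hE : IsL2Eigenvectorfield A E)
    (h_dense : (Submodule.span ℂ (Set.range (circleFourierCoeff E))).topologicalClosure = ⊤)
    (h_sum : Summable fun n : ℤ => circleFourierCoeff E n)
    {z₀ : Z →L[ℂ] ℂ} {c : ℤ →₀ ℂ} (hc : ∀ n, z₀ (circleFourierCoeff E n) = c n) (n₀ m₀ : ℤ)
    (hm₀ : c m₀ ≠ 0) (hm₀_le : ∀ n, c n ≠ 0 → m₀ ≤ n)
    (hn₀ : n₀ = m₀ ∨ n₀ ≤ m₀ ∧ circleFourierCoeff E n₀ ≠ 0 ∧ ∀ n < n₀, circleFourierCoeff E n = 0)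
    {X : Type v} [MeasurableSpace X] [StandardBorelSpace X] {μ : Measure X}
    [IsProbabilityMeasure μ] [NullSingletonClass μ] {T : X → X} (hT : Ergodic T μ)
    {τ : ℤ → X → X}
    (hτ : IsOrbitFamily μ T τ (Function.support fun n => circleFourierCoeff E (n + n₀))) :
    IsModelledBy A μ T := by
  have hle : n₀ ≤ m₀ := hn₀.elim le_of_eq fun h => h.1
  obtain ⟨m, hm⟩ := Int.eq_ofNat_of_zero_le (sub_nonneg.2 hle)
  have hm' : (m : ℤ) + n₀ = m₀ := by lia
  let d : ℕ := c.support.sup fun n => (n - m₀).toNat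
  refine isModelledBy_of_isOrbitFamily (y := fun n => circleFourierCoeff E (n + n₀)) (m := m)
    (d := d) hT ((Equiv.addRight n₀).summable_iff.2 h_sum) (fun n => ?_) hτ ?_ z₀ ?_ ?_ ?_
  · rw [← hE.map_circleFourierCoeff (n + n₀)]
    congr 2
    ring
  · rw [show (fun n => circleFourierCoeff E (n + n₀)) = circleFourierCoeff E ∘ Equiv.addRight n₀
      from rfl, (Equiv.addRight n₀).surjective.range_comp]
    exact h_dense
  · rw [hm', hc]
    exact hm₀
  · intro n hn
    rw [hc] at hn
    have h1 := hm₀_le _ hn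
    have h2 : (n + n₀ - m₀).toNat ≤ d :=
      Finset.le_sup (f := fun n => (n - m₀).toNat) (Finsupp.mem_support_iff.2 hn)
    exact ⟨_, h2, by lia⟩
  · refine hn₀.imp (fun h => by lia) fun h => ⟨by simpa using h.2.1, fun n hn => h.2.2 _ (by lia)⟩

theorem theorem1p5 {Z : Type u} [NormedAddCommGroup Z] [NormedSpace ℂ Z] [CompleteSpace Z]
    [MeasurableSpace Z] [BorelSpace Z] (A : Z →L[ℂ] Z) (E : Circle → Z)
    (hE : IsL2Eigenvectorfield A E)
    (h_span : ∀ B : Set Circle, MeasurableSet B → circleMeasure B = 1 →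
      (Submodule.span ℂ (E '' B)).topologicalClosure = ⊤)
    (h_poly : ∃ z₀ : Z →L[ℂ] ℂ, z₀ ≠ 0 ∧ ∃ c : ℤ →₀ ℂ,
      ∀ᵐ l ∂circleMeasure, z₀ (E l) = trigPolyEval c l)
    (h_sum : Summable fun n : ℤ => circleFourierCoeff E n) :
    IsUniversalForInvertibleErgodicSystems.{u, v} A ∧
      ∀ r : ℤ, circleFourierCoeff E (-r) = 0 →
        (∀ n : ℤ, r ≤ n → circleFourierCoeff E (-n) = 0) ∧
          IsUniversalForErgodicSystems.{u, v} A := by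
  obtain ⟨z₀, hz₀, c, hzc⟩ := h_poly
  have h_dense := span_circleFourierCoeff_dense hE.1 h_span
  have hc : ∀ n, z₀ (circleFourierCoeff E n) = c n := fun n => by
    rw [map_circleFourierCoeff hE.1, ← circleFourierCoeff_trigPolyEval c n]
    exact integral_congr_ae (by filter_upwards [hzc] with l hl; rw [hl])
  have hc0 : c ≠ 0 := by
    rintro rfl
    exact hz₀ (eq_zero_of_ae_apply_eq_zero h_span z₀
      (by filter_upwards [hzc] with l hl; rw [hl]; rfl))
  have hne : c.support.Nonempty := Finsupp.support_nonempty_iff.2 hc0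
  obtain ⟨m₀, hm₀, hm₀_le⟩ : ∃ m₀, c m₀ ≠ 0 ∧ ∀ n, c n ≠ 0 → m₀ ≤ n :=
    ⟨c.support.min' hne, Finsupp.mem_support_iff.1 (c.support.min'_mem hne),
      fun n hn => c.support.min'_le n (Finsupp.mem_support_iff.2 hn)⟩
  refine ⟨?_, fun r hr => ?_⟩
  · intro X _ _ μ _ _ T hT ⟨S, hS, hST, hTS⟩
    exact isModelledBy_of_circleFourierCoeff hE h_dense h_sum hc m₀ m₀ hm₀ hm₀_le (Or.inl rfl) hT
      (isOrbitFamily_of_inverse hT.toMeasurePreserving hS hST hTS _)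
  · have hr' : ∀ n : ℤ, r ≤ n → circleFourierCoeff E (-n) = 0 := fun n hn =>
      Int.leInduction hr (fun n _ ih => by
        rw [← hE.map_circleFourierCoeff, show -(n + 1) + 1 = -n by ring, ih, map_zero]) n hn
    refine ⟨hr', ?_⟩
    have hm₀E : circleFourierCoeff E m₀ ≠ 0 := fun h0 => hm₀ (by rw [← hc, h0, map_zero])
    obtain ⟨n₀, hn₀, hn₀_le⟩ := Int.exists_least_of_bdd (P := fun n => circleFourierCoeff E n ≠ 0)
      ⟨-r, fun n hn => by
        by_contra hlt
        exact hn (by simpa using hr' (-n) (by lia))⟩ ⟨m₀, hm₀E⟩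
    intro X _ _ μ _ _ T hT
    refine isModelledBy_of_circleFourierCoeff hE h_dense h_sum hc n₀ m₀ hm₀ hm₀_le
      (Or.inr ⟨hn₀_le _ hm₀E, hn₀, fun n hn => ?_⟩) hT
      (isOrbitFamily_of_nonneg hT.toMeasurePreserving fun n hn => ?_)
    · by_contra h
      exact absurd (hn₀_le n h) (by lia)
    · have := hn₀_le _ hn
      lia
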